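/- Let $G$ be the Barnes $G$-function, \[ G(z+1)=(2\pi)^{z/2}e^{-[z(z+1)+\gamma z^2]/2}\prod_{n=1}^{\infty}\left[\left(1+\frac zn\right)^n e^{-z+z^2/(2n)}\right], \] where $\gamma$ is the Euler--Mascheroni constant. Let $B_n$ be the Bernoulli numbers and let $A$ be the Glaisher--Kinkelin constant, $\log A=\frac1{12}-\zeta'(-1)$. For $z\ne0$ with $|\arg z|<\pi$ let $\log G(z+1)$ and $\log\Gamma(z+1)$ be the branches that are continuous in this sector and real for $z>0$, and let $\log z$ be principal. For $N\ge1$ define $R_N(z)$ by \[ \log G(z+1)=\tfrac14z^2+z\log\Gamma(z+1)-\left(\tfrac12z(z+1)+\tfrac1{12}\right)\log z-\log A+\sum_{n=1}^{N-1}\frac{B_{2n+2}}{2n(2n+1)(2n+2)z^{2n}}+R_N(z). \] Let $z\neq 0$ and $\theta=\arg z$. Then, for every $N\ge1$, if $|\theta|\le\frac{\pi}{2}$, \[ |R_N(z)|\le\frac{|B_{2N+2}|}{2N(2N+1)(2N+2)|z|^{2N}}\times\begin{cases}\min\left(|\csc(2\theta)|,\sqrt{\tfrac e4\left(2N+\tfrac52\right)}\right)&\text{if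 }\frac\pi4<|\theta|\le\frac\pi2,\\ 1&\text{if }|\theta|\le\frac\pi4,\end{cases} \] where for $|\theta|=\frac\pi2$ the cosecant is read as $+\infty$, so that the minimum is the square root; and, if $|\theta|<\pi$, \[ |R_N(z)|\le\frac{|B_{2N+2}|}{2N(2N+1)(2N+2)|z|^{2N}}\sec^{2N+1}\left(\frac\theta2\right). \] Moreover, if $z>0$, then $R_N(z)$ is real, it has the same sign as the first neglected term $\dfrac{B_{2N+2}}{2N(2N+1)(2N+2)z^{2N}}$ (in particular neither is zero), and its absolute value is strictly smaller than the absolute value of that term. -/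

import Mathlib

open Complex Set Filter Topology

/-- The Barnes `G`-function through its Weierstrass product
`G(z+1) = (2π)^{z/2} e^{-[z(z+1) + γ z²]/2} ∏_{n ≥ 1} (1 + z/n)^n e^{-z + z²/(2n)}`;
here `z = w - 1`, and the product index `n : ℕ` is shifted by one. -/
noncomputable def barnesG (w : ℂ) : ℂ :=
  (2 * (Real.pi : ℂ)) ^ ((w - 1) / 2) *
    exp (-((w - 1) * (w - 1 + 1) + (Real.eulerMascheroniConstant : ℂ) * (w - 1) ^ 2) / 2) *
    ∏' n : ℕ, ((1 + (w - 1) / ((n : ℂ) + 1)) ^ (n + 1) *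
      exp (-(w - 1) + (w - 1) ^ 2 / (2 * ((n : ℂ) + 1))))

/-- `L` is the branch of `log f` on the cut plane `|arg z| < π` (that is, on `ℂ` without the
half-line `(-∞, 0]`) which is continuous there and real on the positive real axis. -/
def IsLogBranch (f L : ℂ → ℂ) : Prop :=
  ContinuousOn L slitPlane ∧ (∀ z ∈ slitPlane, exp (L z) = f z) ∧
    ∀ x : ℝ, 0 < x → (L (x : ℂ)).im = 0

/-- The branch of `log f` on the cut plane that is continuous and real on the positive real axis.
It exists for `f z = G (z + 1)` and for `f z = Γ (z + 1)`, and is unique: see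
`isLogBranch_logBarnesG`, `isLogBranch_logGamma` and `IsLogBranch.eqOn` below. -/
noncomputable def logBranch (f : ℂ → ℂ) : ℂ → ℂ :=
  Classical.epsilon (IsLogBranch f)

/-- `log G(z + 1)` for `|arg z| < π`. -/
noncomputable def logBarnesGAddOne : ℂ → ℂ := logBranch fun z => barnesG (z + 1)

/-- `log Γ(z + 1)` for `|arg z| < π`. -/
noncomputable def logGammaAddOne : ℂ → ℂ := logBranch fun z => Gamma (z + 1)

/-- The Glaisher–Kinkelin constant `A = exp (1/12 - ζ'(-1))` (the value `ζ'(-1)` is real). -/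
noncomputable def glaisherA : ℝ := Real.exp (1 / 12 - (deriv riemannZeta (-1)).re)

/-- The `n`-th term `B_{2n+2} / (2n (2n+1) (2n+2) z^{2n})` of the asymptotic series. -/
noncomputable def barnesTerm (n : ℕ) (z : ℂ) : ℂ :=
  (bernoulli (2 * n + 2) : ℂ) /
    (2 * (n : ℂ) * (2 * (n : ℂ) + 1) * (2 * (n : ℂ) + 2) * z ^ (2 * n))

/-- The remainder `R_N(z)`, defined by
`log G(z+1) = z²/4 + z log Γ(z+1) - (z(z+1)/2 + 1/12) log z - log A
  + ∑_{n=1}^{N-1} B_{2n+2} / (2n (2n+1) (2n+2) z^{2n}) + R_N(z)`. -/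
noncomputable def barnesRemainder (N : ℕ) (z : ℂ) : ℂ :=
  logBarnesGAddOne z -
    (z ^ 2 / 4 + z * logGammaAddOne z - (z * (z + 1) / 2 + 1 / 12) * log z
      - (Real.log glaisherA : ℂ) + ∑ n ∈ Finset.Ico 1 N, barnesTerm n z)

/-- The factor in the sector `|θ| ≤ π/2`: it is `1` for `|θ| ≤ π/4`, and
`min (|csc 2θ|, √(e (2N + 5/2) / 4))` for `π/4 < |θ| ≤ π/2`. At `|θ| = π/2` the cosecant is
infinite, so that the minimum is the second entry. -/
noncomputable def sectorFactor (N : ℕ) (θ : ℝ) : ℝ :=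
  if |θ| ≤ Real.pi / 4 then 1
  else if |θ| < Real.pi / 2 then
    min |(Real.sin (2 * θ))⁻¹| (Real.sqrt (Real.exp 1 / 4 * (2 * (N : ℝ) + 5 / 2)))
  else Real.sqrt (Real.exp 1 / 4 * (2 * (N : ℝ) + 5 / 2))

/-! ### Existence and uniqueness of the logarithms -/

theorem eq_zero_of_exp_eq_one_on {S : Set ℂ} (hS : IsPreconnected S) {g : ℂ → ℂ}
    (hg : ContinuousOn g S) (he : ∀ z ∈ S, exp (g z) = 1) {a : ℂ} (ha : a ∈ S)
    (h0 : g a = 0) : ∀ z ∈ S, g z = 0 := by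
  have hpi : (2 * (Real.pi : ℂ) * I) ≠ 0 := by simp [Real.pi_ne_zero]
  have hm : MapsTo (fun z => (g z / (2 * (Real.pi : ℂ) * I)).re) S
      (Set.range ((↑) : ℤ → ℝ)) := by
    intro z hz
    obtain ⟨n, hn⟩ := Complex.exp_eq_one_iff.1 (he z hz)
    refine ⟨n, ?_⟩
    simp only [hn, mul_div_assoc, div_self hpi]
    simp
  have hc : ContinuousOn (fun z => (g z / (2 * (Real.pi : ℂ) * I)).re) S :=
    Complex.continuous_re.comp_continuousOn (hg.div_const _)
  intro z hz
  have hd : IsDiscrete (Set.range ((↑) : ℤ → ℝ)) :=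
    Int.isClosedEmbedding_coe_real.isInducing.isDiscrete_range
  have h := hS.constant_of_mapsTo hd hc hm hz ha
  obtain ⟨n, hn⟩ := Complex.exp_eq_one_iff.1 (he z hz)
  simp only [hn, h0, mul_div_assoc, div_self hpi] at h
  simp at h
  simp [hn, h]

theorem isPreconnected_slitPlane : IsPreconnected slitPlane :=
  (starConvex_one_slitPlane.isPathConnected one_mem_slitPlane).isConnected.isPreconnected

/-- The branch is unique. -/
theorem IsLogBranch.eqOn {f L M : ℂ → ℂ} (hL : IsLogBranch f L) (hM : IsLogBranch f M) :
    EqOn L M slitPlane := by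
  have h1 : L 1 - M 1 = 0 := by
    have he : exp (L 1 - M 1) = 1 := by
      rw [exp_sub, hL.2.1 1 one_mem_slitPlane, hM.2.1 1 one_mem_slitPlane, div_self]
      rw [← hL.2.1 1 one_mem_slitPlane]
      exact exp_ne_zero _
    obtain ⟨n, hn⟩ := Complex.exp_eq_one_iff.1 he
    have hi : (L 1 - M 1).im = 0 := by
      have a := hL.2.2 1 one_pos
      have b := hM.2.2 1 one_pos
      simp only [ofReal_one] at a b
      simp [a, b]
    rw [hn] at hi ⊢
    simp [Real.pi_ne_zero] at hi
    simp [hi]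
  intro z hz
  have h := eq_zero_of_exp_eq_one_on isPreconnected_slitPlane (hL.1.sub hM.1) (fun z hz => by
    rw [Pi.sub_apply, exp_sub, hL.2.1 z hz, hM.2.1 z hz, div_self]
    rw [← hL.2.1 z hz]
    exact exp_ne_zero _) one_mem_slitPlane h1 z hz
  exact sub_eq_zero.1 h

theorem isLogBranch_logBranch {f : ℂ → ℂ} (h : ∃ L, IsLogBranch f L) :
    IsLogBranch f (logBranch f) :=
  Classical.epsilon_spec h

/-- Existence, for a continuous zero-free `f` that is positive on the positive real axis. -/
theorem exists_isLogBranch {f : ℂ → ℂ} (hf : ContinuousOn f slitPlane)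
    (h0 : ∀ z ∈ slitPlane, f z ≠ 0) (hp : ∀ x : ℝ, 0 < x → ∃ y : ℝ, 0 < y ∧ f x = y) :
    ∃ L, IsLogBranch f L := by
  have hsc : IsSimplyConnected slitPlane := by
    have : ContractibleSpace slitPlane :=
      starConvex_one_slitPlane.contractibleSpace (Set.nonempty_of_mem one_mem_slitPlane)
    exact (inferInstance : SimplyConnectedSpace slitPlane)
  obtain ⟨L, hLc, hLe⟩ := exists_continuousOn_eqOn_exp_comp hsc isOpen_slitPlane hf
    (by rintro ⟨z, hz, h⟩; exact h0 z hz h)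
  have he : ∀ z ∈ slitPlane, exp (L z) = f z := fun z hz => hLe hz
  obtain ⟨y₁, hy₁, hfy₁⟩ := hp 1 one_pos
  simp only [ofReal_one] at hfy₁
  have hc1 : exp (L 1 - (Real.log y₁ : ℂ)) = 1 := by
    rw [exp_sub, he 1 one_mem_slitPlane, hfy₁, ← ofReal_exp, Real.exp_log hy₁, div_self]
    exact_mod_cast hy₁.ne'
  have hmem : ∀ {x : ℝ}, 0 < x → (x : ℂ) ∈ slitPlane := fun hx => ofReal_mem_slitPlane.2 hx
  refine ⟨fun z => L z - (L 1 - (Real.log y₁ : ℂ)), hLc.sub continuousOn_const,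
    fun z hz => by rw [exp_sub, hc1, he z hz, div_one], ?_⟩
  have hpre : IsPreconnected ((fun x : ℝ => (x : ℂ)) '' Ioi 0) :=
    isPreconnected_Ioi.image _ continuous_ofReal.continuousOn
  have hsub : ((fun x : ℝ => (x : ℂ)) '' Ioi 0) ⊆ slitPlane := by
    rintro _ ⟨x, hx, rfl⟩
    exact hmem hx
  have hlog : ContinuousOn (fun z : ℂ => ((Real.log ‖f z‖ : ℝ) : ℂ)) slitPlane :=
    continuous_ofReal.comp_continuousOn
      (ContinuousOn.log hf.norm fun z hz => norm_ne_zero_iff.2 (h0 z hz))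
  have key := eq_zero_of_exp_eq_one_on hpre
    (g := fun z => L z - (L 1 - (Real.log y₁ : ℂ)) - ((Real.log ‖f z‖ : ℝ) : ℂ))
    (((hLc.sub continuousOn_const).sub hlog).mono hsub)
    (by
      rintro _ ⟨x, hx, rfl⟩
      obtain ⟨y, hy, hfy⟩ := hp x hx
      have hn : ‖f (x : ℂ)‖ = y := by rw [hfy, norm_real, Real.norm_of_nonneg hy.le]
      simp only
      rw [exp_sub, exp_sub, hc1, he _ (hmem hx), hn, ← ofReal_exp, Real.exp_log hy, hfy, div_one,
        div_self]
      exact_mod_cast hy.ne')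
    (a := 1) ⟨1, mem_Ioi.2 one_pos, by simp⟩
    (by simp [hfy₁, Real.norm_of_nonneg hy₁.le])
  intro x hx
  have h := key x ⟨x, hx, rfl⟩
  rw [sub_eq_zero] at h
  simp only [h, ofReal_im]

/-- `log Γ(z + 1)` is a continuous logarithm of `Γ(z + 1)`, real on the positive axis. -/
theorem isLogBranch_logGamma : IsLogBranch (fun z => Gamma (z + 1)) logGammaAddOne := by
  have hne : ∀ z ∈ slitPlane, ∀ m : ℕ, z + 1 ≠ -(m : ℂ) := by
    intro z hz m h
    have hz' : z = ((-(m : ℝ) - 1 : ℝ) : ℂ) := by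
      push_cast
      linear_combination h
    rw [hz', ofReal_mem_slitPlane] at hz
    have : (0 : ℝ) ≤ m := Nat.cast_nonneg m
    linarith
  refine isLogBranch_logBranch (exists_isLogBranch ?_ ?_ ?_)
  · intro z hz
    have h : ContinuousAt Gamma (z + 1) := (differentiableAt_Gamma _ (hne z hz)).continuousAt
    exact (ContinuousAt.comp (f := fun z : ℂ => z + 1) h (by fun_prop)).continuousWithinAt
  · exact fun z hz => Gamma_ne_zero (hne z hz)
  · intro x hx
    refine ⟨Real.Gamma (x + 1), Real.Gamma_pos_of_pos (by linarith), ?_⟩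
    rw [← Gamma_ofReal]
    push_cast
    rfl

/-- The logarithm of the `n`-th factor of the Weierstrass product. -/
noncomputable def barnesLogFactor (n : ℕ) (z : ℂ) : ℂ :=
  ((n : ℂ) + 1) * log (1 + z / ((n : ℂ) + 1)) - z + z ^ 2 / (2 * ((n : ℂ) + 1))

theorem norm_barnesLogFactor_le {R : ℝ} {n : ℕ} (hn : 2 * R ≤ (n : ℝ) + 1) {z : ℂ}
    (hz : ‖z‖ ≤ R) : ‖barnesLogFactor n z‖ ≤ R ^ 3 * (1 / ((n : ℝ) + 1) ^ 2) := by
  have hpos : (0 : ℝ) < (n : ℝ) + 1 := by positivity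
  have hR : 0 ≤ R := (norm_nonneg z).trans hz
  have hnc : ((n : ℂ) + 1) ≠ 0 := by exact_mod_cast hpos.ne'
  have hnorm : ‖((n : ℂ) + 1)‖ = (n : ℝ) + 1 := by
    have : ((n : ℂ) + 1) = (((n : ℝ) + 1 : ℝ) : ℂ) := by push_cast; rfl
    rw [this, norm_real, Real.norm_of_nonneg hpos.le]
  set w : ℂ := z / ((n : ℂ) + 1) with hw
  have hwn : ‖w‖ ≤ R / ((n : ℝ) + 1) := by
    rw [hw, norm_div, hnorm]
    gcongr
  have hw2 : ‖w‖ ≤ 1 / 2 := hwn.trans (by rw [div_le_iff₀ hpos]; linarith)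
  have ht : logTaylor 3 w = w - w ^ 2 / 2 := by
    simp [logTaylor_succ, logTaylor_zero]
    ring
  have hb := norm_log_sub_logTaylor_le 2 (z := w) (by linarith)
  rw [ht] at hb
  have hinv : (1 - ‖w‖)⁻¹ ≤ 2 := by
    rw [inv_le_comm₀ (by linarith) two_pos]
    linarith
  have heq : barnesLogFactor n z = ((n : ℂ) + 1) * (log (1 + w) - (w - w ^ 2 / 2)) := by
    have : z = w * ((n : ℂ) + 1) := by rw [hw]; field_simp
    rw [barnesLogFactor, ← hw, this]
    field_simp
    ring
  rw [heq, norm_mul, hnorm]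
  calc ((n : ℝ) + 1) * ‖log (1 + w) - (w - w ^ 2 / 2)‖
      ≤ ((n : ℝ) + 1) * ‖w‖ ^ 3 := by
        gcongr
        refine hb.trans ?_
        have h3 : 0 ≤ ‖w‖ ^ 3 := by positivity
        norm_num
        nlinarith
    _ ≤ ((n : ℝ) + 1) * (R / ((n : ℝ) + 1)) ^ 3 := by gcongr
    _ = R ^ 3 * (1 / ((n : ℝ) + 1) ^ 2) := by field_simp

theorem summable_barnes_bound (R : ℝ) :
    Summable fun n : ℕ => R ^ 3 * (1 / ((n : ℝ) + 1) ^ 2) := by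
  refine Summable.mul_left _ ?_
  have := (summable_nat_add_iff 1).2 (Real.summable_one_div_nat_pow.2 (le_refl 2))
  simpa using this

theorem summable_barnesLogFactor (z : ℂ) : Summable fun n => barnesLogFactor n z := by
  obtain ⟨k, hk⟩ := exists_nat_ge (2 * ‖z‖)
  refine (summable_nat_add_iff k).1 ?_
  refine Summable.of_norm_bounded ((summable_nat_add_iff k).2 (summable_barnes_bound ‖z‖)) ?_
  intro n
  refine norm_barnesLogFactor_le ?_ le_rfl
  push_cast
  have : (0 : ℝ) ≤ n := Nat.cast_nonneg n
  linarith

theorem one_add_div_mem_slitPlane {z : ℂ} (hz : z ∈ slitPlane) (n : ℕ) :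
    1 + z / ((n : ℂ) + 1) ∈ slitPlane := by
  have hpos : (0 : ℝ) < (n : ℝ) + 1 := by positivity
  have : z / ((n : ℂ) + 1) = ((((n : ℝ) + 1)⁻¹ : ℝ) : ℂ) * z := by
    push_cast
    rw [div_eq_mul_inv, mul_comm]
  rw [this, mem_slitPlane_iff]
  rw [mem_slitPlane_iff] at hz
  simp only [add_re, one_re, re_ofReal_mul, add_im, one_im, im_ofReal_mul, zero_add]
  rcases hz with h | h
  · left
    positivity
  · right
    exact mul_ne_zero (inv_ne_zero hpos.ne') h

theorem continuousOn_tsum_barnesLogFactor :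
    ContinuousOn (fun z => ∑' n, barnesLogFactor n z) slitPlane := by
  have hterm : ∀ n, ContinuousOn (barnesLogFactor n) slitPlane := by
    intro n
    unfold barnesLogFactor
    refine ContinuousOn.add (ContinuousOn.sub (continuousOn_const.mul ?_) continuousOn_id)
      (by fun_prop)
    exact ContinuousOn.clog (by fun_prop) fun z hz => one_add_div_mem_slitPlane hz n
  intro z hz
  set R : ℝ := ‖z‖ + 1 with hR
  obtain ⟨k, hk⟩ := exists_nat_ge (2 * R)
  have hc : ContinuousOn (fun z => ∑ i ∈ Finset.range k, barnesLogFactor i z +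
      ∑' n, barnesLogFactor (n + k) z) (slitPlane ∩ Metric.ball 0 R) := by
    refine ContinuousOn.add (continuousOn_finsetSum _ fun i _ =>
      (hterm i).mono inter_subset_left) ?_
    refine continuousOn_tsum (fun n => (hterm (n + k)).mono inter_subset_left)
      ((summable_nat_add_iff k).2 (summable_barnes_bound R)) ?_
    intro n w hw
    refine norm_barnesLogFactor_le ?_ (by simpa using (mem_ball_zero_iff.1 hw.2).le)
    push_cast
    have : (0 : ℝ) ≤ n := Nat.cast_nonneg n
    linarith
  have hop : IsOpen (slitPlane ∩ Metric.ball (0 : ℂ) R) := isOpen_slitPlane.inter Metric.isOpen_ball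
  have hzm : z ∈ slitPlane ∩ Metric.ball (0 : ℂ) R := ⟨hz, by simp [hR]⟩
  have hca := hc.continuousAt (hop.mem_nhds hzm)
  have hfun : (fun z => ∑ i ∈ Finset.range k, barnesLogFactor i z +
      ∑' n, barnesLogFactor (n + k) z) = fun z => ∑' n, barnesLogFactor n z := by
    funext z
    exact (summable_barnesLogFactor z).sum_add_tsum_nat_add k
  rw [hfun] at hca
  exact hca.continuousWithinAt

theorem barnesG_add_one_eq {z : ℂ} (hz : z ∈ slitPlane) :
    barnesG (z + 1) = (2 * (Real.pi : ℂ)) ^ (z / 2) *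
      exp (-(z * (z + 1) + (Real.eulerMascheroniConstant : ℂ) * z ^ 2) / 2) *
      exp (∑' n, barnesLogFactor n z) := by
  have h := (summable_barnesLogFactor z).hasSum.cexp.tprod_eq
  rw [barnesG, ← h]
  simp only [add_sub_cancel_right]
  congr 1
  refine tprod_congr fun n => ?_
  have : barnesLogFactor n z = ((n + 1 : ℕ) : ℂ) * log (1 + z / ((n : ℂ) + 1)) +
      (-z + z ^ 2 / (2 * ((n : ℂ) + 1))) := by
    rw [barnesLogFactor]
    push_cast
    ring
  rw [Function.comp_apply, this, exp_add (((n + 1 : ℕ) : ℂ) * _), exp_nat_mul, exp_log (slitPlane_ne_zero (one_add_div_mem_slitPlane hz n))]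

/-- `log G(z + 1)` is a continuous logarithm of `G(z + 1)`, real on the positive axis. -/
theorem isLogBranch_logBarnesG : IsLogBranch (fun z => barnesG (z + 1)) logBarnesGAddOne := by
  have h2pi : (2 * (Real.pi : ℂ)) ≠ 0 := by simp [Real.pi_ne_zero]
  refine isLogBranch_logBranch (exists_isLogBranch ?_ ?_ ?_)
  · refine ContinuousOn.congr ?_ fun z hz => barnesG_add_one_eq hz
    refine ContinuousOn.mul (ContinuousOn.mul ?_ (by fun_prop))
      continuousOn_tsum_barnesLogFactor.cexp
    exact ContinuousOn.const_cpow (by fun_prop) (Or.inl h2pi)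
  · intro z hz
    simp only [barnesG_add_one_eq hz]
    exact mul_ne_zero (mul_ne_zero (by simp [cpow_eq_zero_iff, h2pi]) (exp_ne_zero _))
      (exp_ne_zero _)
  · intro x hx
    have hfac : ∀ n : ℕ, barnesLogFactor n (x : ℂ) =
        ((((n : ℝ) + 1) * Real.log (1 + x / ((n : ℝ) + 1)) - x +
          x ^ 2 / (2 * ((n : ℝ) + 1)) : ℝ) : ℂ) := by
      intro n
      have hpos : (0 : ℝ) ≤ 1 + x / ((n : ℝ) + 1) := by positivity
      have hl := ofReal_log hpos
      push_cast at hl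
      rw [barnesLogFactor, ← hl]
      push_cast
      rfl
    refine ⟨(2 * Real.pi) ^ (x / 2) *
      Real.exp (-(x * (x + 1) + Real.eulerMascheroniConstant * x ^ 2) / 2) *
      Real.exp (∑' n : ℕ, (((n : ℝ) + 1) * Real.log (1 + x / ((n : ℝ) + 1)) - x +
          x ^ 2 / (2 * ((n : ℝ) + 1)))), by positivity, ?_⟩
    simp only [barnesG_add_one_eq (ofReal_mem_slitPlane.2 hx), hfac, ← ofReal_tsum]
    have hcp := ofReal_cpow (show (0 : ℝ) ≤ 2 * Real.pi by positivity) (x / 2)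
    push_cast at hcp ⊢
    rw [hcp]

/-!
Write `f w = w log w`. The Weierstrass products of `G(z + 1)` and `Γ(z + 1)` show that
`log G(z + 1) - z log Γ(z + 1)` is, up to elementary terms, the limit of `∑ f(z + n) - ∑ f(n)`.
Euler–Maclaurin summation of order four of both sums identifies the remainder `R_1(z)` with the
sum of the errors over the unit cells `[z + n, z + n + 1]` (`tendsto_sum_mulLogCell`). The
constant is right because the same summation applied to `∑ n ^ (-s)` continues `ζ` to a
neighbourhood of `-1`, and minus its derivative there is the sum for `f`
(`hasSum_mulLogCell_glaisherA`).

The errors have the kernel `B₄({x}) - B₄`, and its Fourier series gives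
`R_1(z) = -∑_k (4 / a_k⁴) ∫₀^∞ (1 - cos (a_k x)) / (z + x)³ dx` with `a_k = 2π(k + 1)`.
Inserting `2 / (z + x)³ = ∫₀^∞ (α s)² e^{-α s (z + x)} α ds`, for any `α` with `Re α > 0` and
`Re (α z) > 0`, and exchanging the integrals (`integral_one_sub_cos_div_cube`) yields a Laplace
integral along the ray through `α`; the freedom in `α` replaces both the rotation of contours and
analytic continuation. Splitting off geometric terms, one finds for every `N ≥ 1`
`R_N(z) = (-1)^N ∑_k 2 a_k^{-2N-2} ∫₀^∞ (α s)^{2N-1} e^{-α s z} / (1 + (α s / a_k)²) α ds`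
(`hasSum_barnesRemainder`).

With `α = e^{iβ}` and `θ = arg z`, the modulus of the integral is at most
`(2N - 1)! / (|z| cos (θ + β))^{2N}` times `1` if `|β| ≤ π / 4`, or times `|csc 2β|` if `β ≠ 0`;
and `∑_k 2 a_k^{-2N-2} (2N - 1)!` is the constant of the first neglected term. The choice
`β = -θ` gives the bounds `1` and `|csc 2θ|`, the choice `β = -θ / 2` gives the power of the
secant, and the minimisation of `csc 2φ sec^{2N} φ` gives the square root. For `z > 0` and
`α = 1` the integrals are positive, so the signs of the `R_N` alternate, and the first neglected
term is `R_N - R_{N+1}`.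
-/

/-! ### The Euler–Maclaurin formula on a unit interval -/

/-- The Euler–Maclaurin formula of order four on `[0, 1]`, for a function `f` with primitive `F`
and derivatives `f₁, …, f₄`: the kernel is `x² (1 - x)² = B₄(x) - B₄`. -/
theorem integral_kernel_mul_eq {F f f₁ f₂ f₃ f₄ : ℝ → ℂ}
    (hF : ∀ x ∈ Icc (0 : ℝ) 1, HasDerivAt F (f x) x)
    (hf : ∀ x ∈ Icc (0 : ℝ) 1, HasDerivAt f (f₁ x) x)
    (hf₁ : ∀ x ∈ Icc (0 : ℝ) 1, HasDerivAt f₁ (f₂ x) x)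
    (hf₂ : ∀ x ∈ Icc (0 : ℝ) 1, HasDerivAt f₂ (f₃ x) x)
    (hf₃ : ∀ x ∈ Icc (0 : ℝ) 1, HasDerivAt f₃ (f₄ x) x)
    (hf₄ : ContinuousOn f₄ (Icc 0 1)) :
    ∫ x in (0 : ℝ)..1, ((x ^ 2 * (1 - x) ^ 2 : ℝ) : ℂ) * f₄ x =
      24 * (F 1 - F 0) - 12 * (f 0 + f 1) + 2 * (f₁ 1 - f₁ 0) := by
  have hderiv : ∀ x ∈ uIcc (0 : ℝ) 1, HasDerivAt
      (fun x : ℝ => ((x : ℂ) ^ 4 - 2 * (x : ℂ) ^ 3 + (x : ℂ) ^ 2) * f₃ x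
        - (4 * (x : ℂ) ^ 3 - 6 * (x : ℂ) ^ 2 + 2 * (x : ℂ)) * f₂ x
        + (12 * (x : ℂ) ^ 2 - 12 * (x : ℂ) + 2) * f₁ x
        - (24 * (x : ℂ) - 12) * f x + 24 * F x)
      (((x ^ 2 * (1 - x) ^ 2 : ℝ) : ℂ) * f₄ x) x := by
    intro x hx
    rw [uIcc_of_le zero_le_one] at hx
    have hid : HasDerivAt (fun x : ℝ => (x : ℂ)) 1 x := hasDerivAt_id x |>.ofReal_comp
    have h1 := (((hid.fun_pow 4).sub ((hid.fun_pow 3).const_mul 2)).add (hid.fun_pow 2)).mul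
      (hf₃ x hx)
    have h2 := ((((hid.fun_pow 3).const_mul 4).sub ((hid.fun_pow 2).const_mul 6)).add
      (hid.const_mul 2)).mul (hf₂ x hx)
    have h3 := ((((hid.fun_pow 2).const_mul 12).sub (hid.const_mul 12)).add_const 2).mul (hf₁ x hx)
    have h4 := ((hid.const_mul 24).sub_const 12).mul (hf x hx)
    have h5 := (hF x hx).const_mul 24
    have h := (((h1.sub h2).add h3).sub h4).add h5
    refine HasDerivAt.congr_deriv h ?_
    simp only [Pi.add_apply, Pi.sub_apply]
    push_cast
    ring
  rw [intervalIntegral.integral_eq_sub_of_hasDerivAt hderiv]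
  · push_cast
    ring
  · refine ContinuousOn.intervalIntegrable ?_
    rw [uIcc_of_le zero_le_one]
    exact ContinuousOn.mul (by fun_prop) hf₄

theorem add_nonneg_mem_slitPlane {w : ℂ} (hw : w ∈ slitPlane) {x : ℝ} (hx : 0 ≤ x) :
    w + x ∈ slitPlane := by
  rw [mem_slitPlane_iff] at hw ⊢
  simp only [add_re, ofReal_re, add_im, ofReal_im, add_zero]
  rcases hw with h | h
  · left; linarith
  · right; exact h

/-- The Euler–Maclaurin primitive `∫ f - f / 2 + f' / 12` (up to a constant) of `f w = w log w`. -/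
noncomputable def mulLogPrimitive (w : ℂ) : ℂ :=
  w ^ 2 / 2 * log w - w ^ 2 / 4 - w / 2 * log w + log w / 12

/-- The Euler–Maclaurin error of `f w = w log w` over the unit cell `[w, w + 1]`. -/
noncomputable def mulLogCell (w : ℂ) : ℂ :=
  w * log w - (mulLogPrimitive (w + 1) - mulLogPrimitive w)

/-- Order four suffices: the fourth derivative `2 / w³` of `w log w` is summable along `w + n`. -/
theorem mulLogCell_eq_integral {w : ℂ} (hw : w ∈ slitPlane) :
    mulLogCell w =
      -(1 / 12) * ∫ x in (0 : ℝ)..1, ((x ^ 2 * (1 - x) ^ 2 : ℝ) : ℂ) * (1 / (w + x) ^ 3) := by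
  have hm : ∀ x ∈ Icc (0 : ℝ) 1, w + x ∈ slitPlane := fun x hx => add_nonneg_mem_slitPlane hw hx.1
  have hid : ∀ x : ℝ, HasDerivAt (fun x : ℝ => w + (x : ℂ)) 1 x := fun x =>
    ((hasDerivAt_id x).ofReal_comp).const_add w
  have hlog : ∀ x ∈ Icc (0 : ℝ) 1, HasDerivAt (fun x : ℝ => log (w + x)) (1 / (w + x)) x :=
    fun x hx => (hid x).clog_real (hm x hx)
  have hinv : ∀ (n : ℕ), ∀ x ∈ Icc (0 : ℝ) 1,
      HasDerivAt (fun x : ℝ => 1 / (w + x) ^ (n + 1)) (-(n + 1) / (w + x) ^ (n + 2)) x := by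
    intro n x hx
    have h0 := slitPlane_ne_zero (hm x hx)
    have h := ((hid x).fun_pow (n + 1)).fun_inv (pow_ne_zero _ h0)
    simp only [one_div]
    refine h.congr_deriv ?_
    rw [div_eq_div_iff (pow_ne_zero _ (pow_ne_zero _ h0)) (pow_ne_zero _ h0)]
    push_cast
    ring
  have key := integral_kernel_mul_eq
    (F := fun x : ℝ => (w + x) ^ 2 / 2 * log (w + x) - (w + x) ^ 2 / 4)
    (f := fun x : ℝ => (w + x) * log (w + x)) (f₁ := fun x : ℝ => log (w + x) + 1)
    (f₂ := fun x : ℝ => 1 / (w + x) ^ (0 + 1)) (f₃ := fun x : ℝ => -1 * (1 / (w + x) ^ (1 + 1)))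
    (f₄ := fun x : ℝ => 2 * (1 / (w + x) ^ 3)) ?_ ?_ ?_ ?_ ?_ ?_
  · have hint : ∫ x in (0 : ℝ)..1, ((x ^ 2 * (1 - x) ^ 2 : ℝ) : ℂ) * (2 * (1 / (w + x) ^ 3)) =
        2 * ∫ x in (0 : ℝ)..1, ((x ^ 2 * (1 - x) ^ 2 : ℝ) : ℂ) * (1 / (w + x) ^ 3) := by
      rw [← intervalIntegral.integral_const_mul]
      congr 1 with x
      ring
    rw [hint] at key
    simp only [ofReal_one, ofReal_zero, add_zero] at key
    rw [mulLogCell, mulLogPrimitive, mulLogPrimitive]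
    linear_combination (1 / 24) * key
  · intro x hx
    have h0 := slitPlane_ne_zero (hm x hx)
    have h := ((((hid x).fun_pow 2).div_const 2).mul (hlog x hx)).sub
      (((hid x).fun_pow 2).div_const 4)
    refine h.congr_deriv ?_
    field_simp
    norm_num
    ring
  · intro x hx
    have h0 := slitPlane_ne_zero (hm x hx)
    refine ((hid x).mul (hlog x hx)).congr_deriv ?_
    field_simp
  · intro x hx
    refine ((hlog x hx).add_const 1).congr_deriv ?_
    simp
  · intro x hx
    refine (hinv 0 x hx).congr_deriv ?_
    norm_num
    rw [neg_div, one_div]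
  · intro x hx
    refine ((hinv 1 x hx).const_mul (-1)).congr_deriv ?_
    push_cast
    ring
  · refine ContinuousOn.mul continuousOn_const (ContinuousOn.div continuousOn_const (by fun_prop) ?_)
    exact fun x hx => pow_ne_zero _ (slitPlane_ne_zero (hm x hx))

theorem norm_integral_kernel_mul_le {f : ℝ → ℂ} {C : ℝ} (hC : ∀ x ∈ Icc (0 : ℝ) 1, ‖f x‖ ≤ C) :
    ‖∫ x in (0 : ℝ)..1, ((x ^ 2 * (1 - x) ^ 2 : ℝ) : ℂ) * f x‖ ≤ C := by
  have h := intervalIntegral.norm_integral_le_of_norm_le_const (a := 0) (b := 1) (C := C)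
    (f := fun x : ℝ => ((x ^ 2 * (1 - x) ^ 2 : ℝ) : ℂ) * f x) ?_
  · simpa using h
  · intro x hx
    rw [uIoc_of_le zero_le_one] at hx
    have h1 : x ^ 2 * (1 - x) ^ 2 ≤ 1 := by
      have := pow_le_one₀ (n := 2) hx.1.le hx.2
      have := pow_le_one₀ (n := 2) (sub_nonneg.2 hx.2) (by linarith [hx.1] : 1 - x ≤ 1)
      exact mul_le_one₀ (by assumption) (by positivity) this
    rw [norm_mul, norm_real, Real.norm_of_nonneg (by positivity)]
    calc _ ≤ 1 * ‖f x‖ := by gcongr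
      _ ≤ C := by rw [one_mul]; exact hC x ⟨hx.1.le, hx.2⟩

/-! ### The derivative of the zeta function at `-1` -/

/-- The Euler–Maclaurin primitive `∫ f - f / 2 + f' / 12` of `f w = w ^ (-s)`. -/
noncomputable def cpowPrimitive (s w : ℂ) : ℂ :=
  w ^ (1 - s) / (1 - s) - w ^ (-s) / 2 - s * w ^ (-s - 1) / 12

/-- The Euler–Maclaurin error of `f w = w ^ (-s)` over the unit cell `[w, w + 1]`. -/
noncomputable def cpowCell (s w : ℂ) : ℂ :=
  w ^ (-s) - (cpowPrimitive s (w + 1) - cpowPrimitive s w)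

/-- Each integration by parts moves the half-plane of convergence of the Dirichlet series to the left;
the factor `w ^ (-s - 4)` makes the errors at `w = n + 1` summable near `s = -1`. -/
theorem cpowCell_eq_integral {s w : ℂ} (hs : s ≠ 1) (hw : w ∈ slitPlane) :
    cpowCell s w = -(1 / 24) * ∫ x in (0 : ℝ)..1, ((x ^ 2 * (1 - x) ^ 2 : ℝ) : ℂ) *
      (s * (s + 1) * (s + 2) * (s + 3) * (w + x) ^ (-s - 4)) := by
  have hm : ∀ x ∈ Icc (0 : ℝ) 1, w + x ∈ slitPlane := fun x hx => add_nonneg_mem_slitPlane hw hx.1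
  have hpow : ∀ c : ℂ, ∀ x ∈ Icc (0 : ℝ) 1,
      HasDerivAt (fun x : ℝ => (w + x) ^ c) (c * (w + x) ^ (c - 1)) x := by
    intro c x hx
    have h := (((hasDerivAt_id (x : ℂ)).const_add w).cpow_const (c := c) (hm x hx)).comp_ofReal
    simpa using h
  have h1s : 1 - s ≠ 0 := sub_ne_zero.2 hs.symm
  have key := integral_kernel_mul_eq
    (F := fun x : ℝ => (w + x) ^ (1 - s) / (1 - s))
    (f := fun x : ℝ => (w + x) ^ (-s)) (f₁ := fun x : ℝ => -s * (w + x) ^ (-s - 1))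
    (f₂ := fun x : ℝ => s * (s + 1) * (w + x) ^ (-s - 2))
    (f₃ := fun x : ℝ => -(s * (s + 1) * (s + 2)) * (w + x) ^ (-s - 3))
    (f₄ := fun x : ℝ => s * (s + 1) * (s + 2) * (s + 3) * (w + x) ^ (-s - 4)) ?_ ?_ ?_ ?_ ?_ ?_
  · simp only [ofReal_one, ofReal_zero, add_zero] at key
    rw [cpowCell, cpowPrimitive, cpowPrimitive]
    linear_combination (1 / 24) * key
  · intro x hx
    refine ((hpow (1 - s) x hx).div_const (1 - s)).congr_deriv ?_
    rw [show 1 - s - 1 = -s by ring]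
    field_simp
  · exact hpow (-s)
  · intro x hx
    refine ((hpow (-s - 1) x hx).const_mul (-s)).congr_deriv ?_
    rw [show -s - 1 - 1 = -s - 2 by ring]
    ring
  · intro x hx
    refine ((hpow (-s - 2) x hx).const_mul (s * (s + 1))).congr_deriv ?_
    rw [show -s - 2 - 1 = -s - 3 by ring]
    ring
  · intro x hx
    refine ((hpow (-s - 3) x hx).const_mul (-(s * (s + 1) * (s + 2)))).congr_deriv ?_
    rw [show -s - 3 - 1 = -s - 4 by ring]
    ring
  · exact continuousOn_const.mul fun x hx => (hpow _ x hx).continuousAt.continuousWithinAt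

theorem natCast_add_one_mem_slitPlane (n : ℕ) : (n : ℂ) + 1 ∈ slitPlane := by
  rw [mem_slitPlane_iff]
  left
  simp only [add_re, natCast_re, one_re]
  positivity

theorem norm_cpowCell_le {s : ℂ} (hs : s ≠ 1) (hre : -2 < s.re) (hn : ‖s‖ < 10) (n : ℕ) :
    ‖cpowCell s ((n : ℂ) + 1)‖ ≤ 715 * (1 / ((n : ℝ) + 1) ^ 2) := by
  have hpos : (0 : ℝ) < (n : ℝ) + 1 := by positivity
  rw [cpowCell_eq_integral hs (natCast_add_one_mem_slitPlane n), norm_mul]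
  have h := norm_integral_kernel_mul_le
    (f := fun x : ℝ => s * (s + 1) * (s + 2) * (s + 3) * ((n : ℂ) + 1 + x) ^ (-s - 4))
    (C := 10 * 11 * 12 * 13 * (1 / ((n : ℝ) + 1) ^ 2)) ?_
  · calc _ ≤ ‖(-(1 / 24) : ℂ)‖ * (10 * 11 * 12 * 13 * (1 / ((n : ℝ) + 1) ^ 2)) := by gcongr
      _ = _ := by norm_num; ring
  · intro x hx
    have h1 : ‖s + 1‖ ≤ 11 := (norm_add_le _ _).trans (by norm_num; linarith)
    have h2 : ‖s + 2‖ ≤ 12 := (norm_add_le _ _).trans (by norm_num; linarith)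
    have h3 : ‖s + 3‖ ≤ 13 := (norm_add_le _ _).trans (by norm_num; linarith)
    have hb : ‖((n : ℂ) + 1 + x) ^ (-s - 4)‖ ≤ 1 / ((n : ℝ) + 1) ^ 2 := by
      have hx1 : (n : ℝ) + 1 ≤ n + 1 + x := by linarith [hx.1]
      have e : (n : ℂ) + 1 + x = (((n : ℝ) + 1 + x : ℝ) : ℂ) := by push_cast; rfl
      rw [e, norm_cpow_eq_rpow_re_of_pos (by linarith)]
      calc ((n : ℝ) + 1 + x) ^ (-s - 4).re ≤ ((n : ℝ) + 1 + x) ^ (-2 : ℝ) := by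
            refine Real.rpow_le_rpow_of_exponent_le ?_ ?_
            · have : (0 : ℝ) ≤ n := Nat.cast_nonneg n
              linarith
            · simp
              linarith
        _ = 1 / ((n : ℝ) + 1 + x) ^ 2 := by
            rw [Real.rpow_neg (by linarith), one_div]
            norm_num
        _ ≤ 1 / ((n : ℝ) + 1) ^ 2 := by gcongr
    rw [norm_mul, norm_mul, norm_mul, norm_mul]
    gcongr

theorem summable_one_div_add_one_sq (C : ℝ) :
    Summable fun n : ℕ => C * (1 / ((n : ℝ) + 1) ^ 2) := by
  refine Summable.mul_left _ ?_
  simpa using (summable_nat_add_iff 1).2 (Real.summable_one_div_nat_pow.2 (le_refl 2))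

/-- Euler–Maclaurin summation of the Dirichlet series of `ζ`. -/
theorem riemannZeta_eq_tsum_cpowCell_of_one_lt_re {s : ℂ} (hs : 1 < s.re) (hn : ‖s‖ < 10) :
    riemannZeta s = -cpowPrimitive s 1 + ∑' n : ℕ, cpowCell s ((n : ℂ) + 1) := by
  have hs1 : s ≠ 1 := by rintro rfl; simp at hs
  have hsum : Summable fun n : ℕ => cpowCell s ((n : ℂ) + 1) :=
    Summable.of_norm_bounded (summable_one_div_add_one_sq 715)
      fun n => norm_cpowCell_le hs1 (by linarith) hn n
  have hz : HasSum (fun n : ℕ => 1 / ((n : ℂ) + 1) ^ s) (riemannZeta s) := by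
    rw [zeta_eq_tsum_one_div_nat_add_one_cpow hs]
    refine Summable.hasSum ?_
    simpa using (summable_nat_add_iff 1).2 (Complex.summable_one_div_nat_cpow.2 hs)
  have hpart : ∀ M : ℕ, ∑ n ∈ Finset.range M, cpowCell s ((n : ℂ) + 1) =
      ∑ n ∈ Finset.range M, 1 / ((n : ℂ) + 1) ^ s
        - (cpowPrimitive s ((M : ℂ) + 1) - cpowPrimitive s 1) := by
    intro M
    induction M with
    | zero => simp
    | succ M ih =>
      rw [Finset.sum_range_succ, Finset.sum_range_succ, ih, cpowCell, cpow_neg]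
      push_cast
      ring
  have hT : Tendsto (fun M : ℕ => cpowPrimitive s ((M : ℂ) + 1)) atTop (𝓝 0) := by
    have hp : ∀ c : ℂ, c.re < 0 → Tendsto (fun M : ℕ => ((M : ℂ) + 1) ^ c) atTop (𝓝 0) := by
      intro c hc
      rw [tendsto_zero_iff_norm_tendsto_zero]
      have h := ((tendsto_rpow_neg_atTop (neg_pos.2 hc)).comp
        (tendsto_natCast_atTop_atTop (R := ℝ))).comp (tendsto_add_atTop_nat 1)
      refine h.congr fun M => ?_
      have e : (M : ℂ) + 1 = (((M : ℝ) + 1 : ℝ) : ℂ) := by push_cast; rfl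
      rw [e, norm_cpow_eq_rpow_re_of_pos (by positivity)]
      simp
    have h := (((hp (1 - s) (by simp; linarith)).div_const (1 - s)).sub
      ((hp (-s) (by simp; linarith)).div_const 2)).sub
      (((hp (-s - 1) (by simp; linarith)).const_mul s).div_const 12)
    simpa [cpowPrimitive] using h
  have h1 := hsum.hasSum.tendsto_sum_nat
  have h2 := hz.tendsto_sum_nat.sub (hT.sub_const (cpowPrimitive s 1))
  have h3 := tendsto_nhds_unique h1 (h2.congr fun M => (hpart M).symm)
  rw [h3]
  ring

/-- A bounded star-shaped domain that contains `-1`, meets `Re s > 1`, and omits the pole of `ζ`. -/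
def zetaDomain : Set ℂ := {s | -2 < s.re ∧ 1 - s ∈ slitPlane ∧ ‖s‖ < 10}

theorem isOpen_zetaDomain : IsOpen zetaDomain :=
  (isOpen_lt continuous_const continuous_re).inter
    ((isOpen_slitPlane.preimage (by fun_prop : Continuous fun s : ℂ => 1 - s)).inter
      (isOpen_lt continuous_norm continuous_const))

theorem isPreconnected_zetaDomain : IsPreconnected zetaDomain := by
  have h : StarConvex ℝ (0 : ℂ) zetaDomain := by
    intro s hs a b ha hb hab
    obtain ⟨h1, h2, h3⟩ := hs
    simp only [smul_zero, zero_add]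
    have hb1 : b ≤ 1 := by linarith
    refine ⟨?_, ?_, ?_⟩
    · rw [real_smul, re_ofReal_mul]
      rcases hb.eq_or_lt with rfl | hb0
      · norm_num
      · nlinarith
    · have := starConvex_one_slitPlane h2 ha hb hab
      convert this using 1
      simp only [real_smul]
      have : (a : ℂ) + b = 1 := by exact_mod_cast hab
      linear_combination -this
    · rw [norm_smul, Real.norm_of_nonneg hb]
      nlinarith [norm_nonneg s]
  exact (h.isPathConnected ⟨by norm_num, by simp, by simp⟩).isConnected.isPreconnected

theorem ne_one_of_mem_zetaDomain {s : ℂ} (hs : s ∈ zetaDomain) : s ≠ 1 := by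
  rintro rfl
  simpa using slitPlane_ne_zero hs.2.1

theorem neg_one_mem_zetaDomain : (-1 : ℂ) ∈ zetaDomain := by
  refine ⟨by norm_num, ?_, by norm_num⟩
  rw [mem_slitPlane_iff]
  left
  norm_num

theorem hasDerivAt_const_cpow_comp {w : ℂ} (hw : w ≠ 0) {g : ℂ → ℂ} {g' s : ℂ}
    (hg : HasDerivAt g g' s) : HasDerivAt (fun s => w ^ g s) (w ^ g s * log w * g') s :=
  hg.const_cpow (Or.inl hw)

theorem hasDerivAt_cpowPrimitive {w s : ℂ} (hw : w ≠ 0) (hs : s ≠ 1) :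
    HasDerivAt (fun s => cpowPrimitive s w)
      (-(w ^ (1 - s) * log w) / (1 - s) + w ^ (1 - s) / (1 - s) ^ 2 + w ^ (-s) * log w / 2
        - (w ^ (-s - 1) - s * (w ^ (-s - 1) * log w)) / 12) s := by
  have h1s : 1 - s ≠ 0 := sub_ne_zero.2 hs.symm
  have hid := hasDerivAt_id s
  have h1 := (hasDerivAt_const_cpow_comp hw (hid.const_sub 1)).div (hid.const_sub 1) h1s
  have h2 := (hasDerivAt_const_cpow_comp hw hid.neg).div_const 2
  have h3 := (hid.mul (hasDerivAt_const_cpow_comp hw (hid.neg.sub_const 1))).div_const 12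
  refine ((h1.sub h2).sub h3).congr_deriv ?_
  simp only [id, Pi.neg_apply]
  field_simp
  ring

theorem differentiableAt_cpowCell {w s : ℂ} (hw : w ∈ slitPlane) (hs : s ≠ 1) :
    DifferentiableAt ℂ (fun s => cpowCell s w) s := by
  have hw1 : w + 1 ≠ 0 := slitPlane_ne_zero (by
    simpa using add_nonneg_mem_slitPlane hw zero_le_one)
  exact ((hasDerivAt_const_cpow_comp (slitPlane_ne_zero hw)
    (hasDerivAt_id s).neg).differentiableAt).sub
    ((hasDerivAt_cpowPrimitive hw1 hs).differentiableAt.sub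
      (hasDerivAt_cpowPrimitive (slitPlane_ne_zero hw) hs).differentiableAt)

theorem deriv_cpowPrimitive_neg_one {w : ℂ} (hw : w ≠ 0) :
    deriv (fun s => cpowPrimitive s w) (-1) = -mulLogPrimitive w - 1 / 12 := by
  rw [(hasDerivAt_cpowPrimitive hw (by norm_num)).deriv, mulLogPrimitive]
  norm_num
  ring

/-- The constant `-1 / 12` in the derivative of `cpowPrimitive` cancels in the difference. -/
theorem deriv_cpowCell_neg_one {w : ℂ} (hw : w ∈ slitPlane) :
    deriv (fun s => cpowCell s w) (-1) = -mulLogCell w := by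
  have hw0 := slitPlane_ne_zero hw
  have hw1 : w + 1 ≠ 0 := slitPlane_ne_zero (by
    simpa using add_nonneg_mem_slitPlane hw zero_le_one)
  have h1 := hasDerivAt_const_cpow_comp hw0 (hasDerivAt_id (-1)).neg
  have h2 := (hasDerivAt_cpowPrimitive (s := -1) hw1 (by norm_num)).differentiableAt.hasDerivAt
  have h3 := (hasDerivAt_cpowPrimitive (s := -1) hw0 (by norm_num)).differentiableAt.hasDerivAt
  have h := (h1.sub (h2.sub h3)).deriv
  rw [deriv_cpowPrimitive_neg_one hw0, deriv_cpowPrimitive_neg_one hw1] at h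
  refine Eq.trans ?_ (h.trans ?_)
  · rfl
  · rw [mulLogCell]
    simp
    ring

/-- The Euler–Maclaurin series continues `ζ` to a neighbourhood of `-1`. -/
theorem riemannZeta_eq_tsum_cpowCell :
    EqOn riemannZeta (fun s => -cpowPrimitive s 1 + ∑' n : ℕ, cpowCell s ((n : ℂ) + 1))
      zetaDomain := by
  have hd : DifferentiableOn ℂ (fun s => -cpowPrimitive s 1 + ∑' n : ℕ, cpowCell s ((n : ℂ) + 1))
      zetaDomain := by
    refine DifferentiableOn.add (fun s hs => ?_) ?_
    · exact (hasDerivAt_cpowPrimitive one_ne_zero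
        (ne_one_of_mem_zetaDomain hs)).differentiableAt.neg.differentiableWithinAt
    · refine differentiableOn_tsum_of_summable_norm (summable_one_div_add_one_sq 715)
        (fun n s hs => (differentiableAt_cpowCell (natCast_add_one_mem_slitPlane n)
          (ne_one_of_mem_zetaDomain hs)).differentiableWithinAt) isOpen_zetaDomain ?_
      exact fun n s hs => norm_cpowCell_le (ne_one_of_mem_zetaDomain hs) hs.1 hs.2.2 n
  have hz : DifferentiableOn ℂ riemannZeta zetaDomain := fun s hs =>
    (differentiableAt_riemannZeta (ne_one_of_mem_zetaDomain hs)).differentiableWithinAt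
  have hmem : (2 + I : ℂ) ∈ zetaDomain := by
    refine ⟨by norm_num, ?_, ?_⟩
    · rw [mem_slitPlane_iff]
      right
      norm_num
    · refine (norm_add_le _ _).trans_lt ?_
      norm_num
  refine (hz.analyticOnNhd isOpen_zetaDomain).eqOn_of_preconnected_of_eventuallyEq
    (hd.analyticOnNhd isOpen_zetaDomain) isPreconnected_zetaDomain hmem ?_
  have h1 : ∀ᶠ s : ℂ in 𝓝 (2 + I), 1 < s.re :=
    (isOpen_lt continuous_const continuous_re).mem_nhds (by norm_num)
  filter_upwards [h1, isOpen_zetaDomain.mem_nhds hmem] with s hs hs'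
  exact riemannZeta_eq_tsum_cpowCell_of_one_lt_re hs hs'.2.2

/-- The derivative of `w ^ (-s)` in `s` at `-1` is `-w log w`, so that differentiating the
Euler–Maclaurin series of `ζ` term by term gives the errors of `w log w`. -/
theorem hasSum_mulLogCell :
    HasSum (fun n : ℕ => mulLogCell ((n : ℂ) + 1)) (-1 / 6 - deriv riemannZeta (-1)) := by
  have h := Complex.hasSum_deriv_of_summable_norm (z := -1) (U := zetaDomain)
    (F := fun (n : ℕ) s => cpowCell s ((n : ℂ) + 1)) (summable_one_div_add_one_sq 715)
    (fun n s hs => (differentiableAt_cpowCell (natCast_add_one_mem_slitPlane n)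
          (ne_one_of_mem_zetaDomain hs)).differentiableWithinAt) isOpen_zetaDomain
    (fun n s hs => norm_cpowCell_le (ne_one_of_mem_zetaDomain hs) hs.1 hs.2.2 n)
    neg_one_mem_zetaDomain
  have he : (fun s : ℂ => ∑' n : ℕ, cpowCell s ((n : ℂ) + 1)) =ᶠ[𝓝 (-1)]
      fun s => riemannZeta s + cpowPrimitive s 1 := by
    filter_upwards [isOpen_zetaDomain.mem_nhds neg_one_mem_zetaDomain] with s hs
    rw [riemannZeta_eq_tsum_cpowCell hs]
    ring
  rw [he.deriv_eq, deriv_fun_add (differentiableAt_riemannZeta (by norm_num))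
    (hasDerivAt_cpowPrimitive one_ne_zero (by norm_num)).differentiableAt,
    deriv_cpowPrimitive_neg_one one_ne_zero] at h
  have h' := h.neg
  simp only [deriv_cpowCell_neg_one (natCast_add_one_mem_slitPlane _), neg_neg] at h'
  have e : -1 / 6 - deriv riemannZeta (-1) =
      -(deriv riemannZeta (-1) + (-mulLogPrimitive 1 - 1 / 12)) := by
    rw [mulLogPrimitive, log_one]
    ring
  rw [e]
  exact h'

theorem log_natCast_add_one (n : ℕ) : log ((n : ℂ) + 1) = ((Real.log ((n : ℝ) + 1) : ℝ) : ℂ) := by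
  rw [ofReal_log (by positivity)]
  push_cast
  rfl

theorem mulLogCell_natCast_im (n : ℕ) : (mulLogCell ((n : ℂ) + 1)).im = 0 := by
  have h (m : ℕ) : mulLogPrimitive ((m : ℂ) + 1) =
      ((((m : ℝ) + 1) ^ 2 / 2 * Real.log ((m : ℝ) + 1) - ((m : ℝ) + 1) ^ 2 / 4
        - ((m : ℝ) + 1) / 2 * Real.log ((m : ℝ) + 1) + Real.log ((m : ℝ) + 1) / 12 : ℝ) : ℂ) := by
    rw [mulLogPrimitive, log_natCast_add_one]
    push_cast
    rfl
  have h1 := h (n + 1)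
  push_cast at h1
  have h2 : mulLogCell ((n : ℂ) + 1) = ((((n : ℝ) + 1) * Real.log ((n : ℝ) + 1) -
      ((((n : ℝ) + 1 + 1) ^ 2 / 2 * Real.log ((n : ℝ) + 1 + 1) - ((n : ℝ) + 1 + 1) ^ 2 / 4
        - ((n : ℝ) + 1 + 1) / 2 * Real.log ((n : ℝ) + 1 + 1) + Real.log ((n : ℝ) + 1 + 1) / 12) -
      (((n : ℝ) + 1) ^ 2 / 2 * Real.log ((n : ℝ) + 1) - ((n : ℝ) + 1) ^ 2 / 4
        - ((n : ℝ) + 1) / 2 * Real.log ((n : ℝ) + 1) + Real.log ((n : ℝ) + 1) / 12)) : ℝ) : ℂ) := by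
    rw [mulLogCell, h1, h n, log_natCast_add_one]
    push_cast
    rfl
  rw [h2, ofReal_im]

/-- Since all the errors are real, `ζ'(-1)` is real, and taking its real part in `glaisherA` is
harmless. -/
theorem hasSum_mulLogCell_glaisherA :
    HasSum (fun n : ℕ => mulLogCell ((n : ℂ) + 1)) ((Real.log glaisherA : ℂ) - 1 / 4) := by
  have h := hasSum_mulLogCell
  have him := (Complex.hasSum_iff _ _).1 h |>.2
  simp only [mulLogCell_natCast_im] at him
  have h0 : (deriv riemannZeta (-1)).im = 0 := by
    have := him.unique hasSum_zero
    simpa using this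
  have e : ((Real.log glaisherA : ℂ) - 1 / 4) = -1 / 6 - deriv riemannZeta (-1) := by
    rw [glaisherA, Real.log_exp, ← re_add_im (deriv riemannZeta (-1)), h0]
    push_cast
    simp
    ring
  rw [e]
  exact h

/-! ### Series for the logarithms of `Γ(z + 1)` and `G(z + 1)` -/

/-- The logarithm of the inverse of the `n`-th factor of the Weierstrass product of `Γ(z + 1)`. -/
noncomputable def gammaLogFactor (n : ℕ) (z : ℂ) : ℂ :=
  log (1 + z / ((n : ℂ) + 1)) - z / ((n : ℂ) + 1)

theorem norm_natCast_add_one (n : ℕ) : ‖((n : ℂ) + 1)‖ = (n : ℝ) + 1 := by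
  have : ((n : ℂ) + 1) = (((n : ℝ) + 1 : ℝ) : ℂ) := by push_cast; rfl
  rw [this, norm_real, Real.norm_of_nonneg (by positivity)]

theorem norm_gammaLogFactor_le {R : ℝ} {n : ℕ} (hn : 2 * R ≤ (n : ℝ) + 1) {z : ℂ}
    (hz : ‖z‖ ≤ R) : ‖gammaLogFactor n z‖ ≤ R ^ 2 * (1 / ((n : ℝ) + 1) ^ 2) := by
  have hpos : (0 : ℝ) < (n : ℝ) + 1 := by positivity
  set w : ℂ := z / ((n : ℂ) + 1) with hw
  have hwn : ‖w‖ ≤ R / ((n : ℝ) + 1) := by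
    rw [hw, norm_div, norm_natCast_add_one]
    gcongr
  have hw2 : ‖w‖ ≤ 1 / 2 := hwn.trans (by rw [div_le_iff₀ hpos]; linarith)
  have hinv : (1 - ‖w‖)⁻¹ ≤ 2 := by
    rw [inv_le_comm₀ (by linarith) two_pos]
    linarith
  calc ‖gammaLogFactor n z‖ ≤ ‖w‖ ^ 2 * (1 - ‖w‖)⁻¹ / 2 :=
        norm_log_one_add_sub_self_le (by linarith)
    _ ≤ ‖w‖ ^ 2 * 2 / 2 := by gcongr
    _ = ‖w‖ ^ 2 := by ring
    _ ≤ (R / ((n : ℝ) + 1)) ^ 2 := by gcongr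
    _ = R ^ 2 * (1 / ((n : ℝ) + 1) ^ 2) := by field_simp

theorem summable_gammaLogFactor (z : ℂ) : Summable fun n => gammaLogFactor n z := by
  obtain ⟨k, hk⟩ := exists_nat_ge (2 * ‖z‖)
  refine (summable_nat_add_iff k).1 ?_
  refine Summable.of_norm_bounded
    ((summable_nat_add_iff k).2 (summable_one_div_add_one_sq (‖z‖ ^ 2))) ?_
  intro n
  refine norm_gammaLogFactor_le ?_ le_rfl
  push_cast
  have : (0 : ℝ) ≤ n := Nat.cast_nonneg n
  linarith

theorem continuousOn_tsum_gammaLogFactor :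
    ContinuousOn (fun z => ∑' n, gammaLogFactor n z) slitPlane := by
  have hterm : ∀ n, ContinuousOn (gammaLogFactor n) slitPlane := by
    intro n
    unfold gammaLogFactor
    refine ContinuousOn.sub ?_ (by fun_prop)
    exact ContinuousOn.clog (by fun_prop) fun z hz => one_add_div_mem_slitPlane hz n
  intro z hz
  set R : ℝ := ‖z‖ + 1 with hR
  obtain ⟨k, hk⟩ := exists_nat_ge (2 * R)
  have hc : ContinuousOn (fun z => ∑ i ∈ Finset.range k, gammaLogFactor i z +
      ∑' n, gammaLogFactor (n + k) z) (slitPlane ∩ Metric.ball 0 R) := by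
    refine ContinuousOn.add (continuousOn_finsetSum _ fun i _ =>
      (hterm i).mono inter_subset_left) ?_
    refine continuousOn_tsum (fun n => (hterm (n + k)).mono inter_subset_left)
      ((summable_nat_add_iff k).2 (summable_one_div_add_one_sq (R ^ 2))) ?_
    intro n w hw
    refine norm_gammaLogFactor_le ?_ (by simpa using (mem_ball_zero_iff.1 hw.2).le)
    push_cast
    have : (0 : ℝ) ≤ n := Nat.cast_nonneg n
    linarith
  have hop : IsOpen (slitPlane ∩ Metric.ball (0 : ℂ) R) := isOpen_slitPlane.inter Metric.isOpen_ball
  have hzm : z ∈ slitPlane ∩ Metric.ball (0 : ℂ) R := ⟨hz, by simp [hR]⟩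
  have hca := hc.continuousAt (hop.mem_nhds hzm)
  have hfun : (fun z => ∑ i ∈ Finset.range k, gammaLogFactor i z +
      ∑' n, gammaLogFactor (n + k) z) = fun z => ∑' n, gammaLogFactor n z := by
    funext z
    exact (summable_gammaLogFactor z).sum_add_tsum_nat_add k
  rw [hfun] at hca
  exact hca.continuousWithinAt

theorem exp_sum_gammaLogFactor {z : ℂ} (hz : z ∈ slitPlane) (M : ℕ) :
    exp (-∑ n ∈ Finset.range M, gammaLogFactor n z) =
      M.factorial / (∏ n ∈ Finset.range M, (z + 1 + n)) * exp (z * (harmonic M : ℂ)) := by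
  induction M with
  | zero => simp
  | succ M ih =>
    have h0 := Nat.cast_add_one_ne_zero (R := ℂ) M
    have h1 := slitPlane_ne_zero (one_add_div_mem_slitPlane hz M)
    have h2 : 1 + z / ((M : ℂ) + 1) = (z + 1 + M) / ((M : ℂ) + 1) := by
      field_simp
      ring
    have h3 : z + 1 + M ≠ 0 := by
      intro h
      rw [h2, h, zero_div] at h1
      exact h1 rfl
    rw [Finset.sum_range_succ, neg_add, exp_add, ih, gammaLogFactor, neg_sub, exp_sub, exp_log h1,
      Finset.prod_range_succ, Nat.factorial_succ, harmonic_succ, h2]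
    push_cast
    rw [mul_add z, exp_add (z * _), div_eq_mul_inv z]
    have h4 := exp_ne_zero (z * (harmonic M : ℂ))
    have h5 : ∏ n ∈ Finset.range M, (z + 1 + (n : ℂ)) ≠ 0 := by
      rw [Finset.prod_ne_zero_iff]
      intro n _ h
      have := slitPlane_ne_zero (one_add_div_mem_slitPlane hz n)
      apply this
      have hn := Nat.cast_add_one_ne_zero (R := ℂ) n
      field_simp
      linear_combination h
    field_simp

theorem tendsto_harmonic_sub_log_complex :
    Tendsto (fun M : ℕ => (harmonic M : ℂ) - log (M : ℂ)) atTop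
      (𝓝 (Real.eulerMascheroniConstant : ℂ)) := by
  have h := (continuous_ofReal.tendsto _).comp Real.tendsto_harmonic_sub_log
  refine h.congr fun M => ?_
  simp [natCast_log]

/-- The Weierstrass product of `Γ(z + 1)`, from Euler's limit formula. -/
theorem exp_tsum_gammaLogFactor {z : ℂ} (hz : z ∈ slitPlane) :
    exp (-(Real.eulerMascheroniConstant : ℂ) * z - ∑' n, gammaLogFactor n z) = Gamma (z + 1) := by
  have h1 : Tendsto (fun M : ℕ => exp (-∑ n ∈ Finset.range M, gammaLogFactor n z)) atTop
      (𝓝 (exp (-∑' n, gammaLogFactor n z))) :=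
    (continuous_exp.tendsto _).comp (summable_gammaLogFactor z).hasSum.tendsto_sum_nat.neg
  have h2 : Tendsto (fun M : ℕ => exp (-z * ((harmonic M : ℂ) - log (M : ℂ)))) atTop
      (𝓝 (exp (-z * (Real.eulerMascheroniConstant : ℂ)))) :=
    (continuous_exp.tendsto _).comp (tendsto_harmonic_sub_log_complex.const_mul (-z))
  have h3 : Tendsto (fun M : ℕ => (M : ℂ) / ((M : ℂ) + (z + 1))) atTop (𝓝 1) :=
    tendsto_natCast_div_add_atTop (z + 1)
  have h := (h1.mul h2).mul h3
  have h' : Tendsto (fun M : ℕ => GammaSeq (z + 1) M) atTop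
      (𝓝 (exp (-∑' n, gammaLogFactor n z) * exp (-z * (Real.eulerMascheroniConstant : ℂ)) * 1)) := by
    refine h.congr' ?_
    filter_upwards [eventually_ne_atTop 0] with M hM
    have hM' : (M : ℂ) ≠ 0 := by exact_mod_cast hM
    rw [exp_sum_gammaLogFactor hz, GammaSeq, Finset.prod_range_succ, cpow_def_of_ne_zero hM',
      show log (M : ℂ) * (z + 1) = log M * z + log M by ring, exp_add, exp_log hM',
      mul_sub, exp_sub, show -z * log (M : ℂ) = -(log M * z) by ring, exp_neg (log _ * z),
      show -z * (harmonic M : ℂ) = -(z * harmonic M) by ring, exp_neg (z * _),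
      show (M : ℂ) + (z + 1) = z + 1 + M by ring]
    have h4 := exp_ne_zero (z * (harmonic M : ℂ))
    have h5 := exp_ne_zero (log (M : ℂ) * z)
    field_simp
  have := tendsto_nhds_unique h' (GammaSeq_tendsto_Gamma (z + 1))
  rw [← this, mul_one, ← exp_add]
  ring_nf

theorem log_one_add_ofReal_div {x : ℝ} (hx : 0 < x) (n : ℕ) :
    log (1 + (x : ℂ) / ((n : ℂ) + 1)) = ((Real.log (1 + x / ((n : ℝ) + 1)) : ℝ) : ℂ) := by
  rw [ofReal_log (by positivity)]
  push_cast
  rfl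

theorem logGammaAddOne_eq {z : ℂ} (hz : z ∈ slitPlane) :
    logGammaAddOne z =
      -(Real.eulerMascheroniConstant : ℂ) * z - ∑' n, gammaLogFactor n z := by
  have h : IsLogBranch (fun z => Gamma (z + 1))
      (fun z => -(Real.eulerMascheroniConstant : ℂ) * z - ∑' n, gammaLogFactor n z) := by
    refine ⟨ContinuousOn.sub (by fun_prop) continuousOn_tsum_gammaLogFactor,
      fun z hz => exp_tsum_gammaLogFactor hz, fun x hx => ?_⟩
    have : ∀ n, gammaLogFactor n x =
        ((Real.log (1 + x / ((n : ℝ) + 1)) - x / ((n : ℝ) + 1) : ℝ) : ℂ) := by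
      intro n
      rw [gammaLogFactor, log_one_add_ofReal_div hx]
      push_cast
      rfl
    simp only [this, ← ofReal_tsum]
    simp
  exact isLogBranch_logGamma.eqOn h hz

theorem logBarnesGAddOne_eq {z : ℂ} (hz : z ∈ slitPlane) :
    logBarnesGAddOne z = z / 2 * log (2 * (Real.pi : ℂ))
      - (z * (z + 1) + (Real.eulerMascheroniConstant : ℂ) * z ^ 2) / 2
      + ∑' n, barnesLogFactor n z := by
  have h2pi : (2 * (Real.pi : ℂ)) ≠ 0 := by simp [Real.pi_ne_zero]
  have h : IsLogBranch (fun z => barnesG (z + 1))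
      (fun z => z / 2 * log (2 * (Real.pi : ℂ))
      - (z * (z + 1) + (Real.eulerMascheroniConstant : ℂ) * z ^ 2) / 2
      + ∑' n, barnesLogFactor n z) := by
    refine ⟨ContinuousOn.add (by fun_prop) continuousOn_tsum_barnesLogFactor,
      fun z hz => ?_, fun x hx => ?_⟩
    · simp only [barnesG_add_one_eq hz]
      rw [cpow_def_of_ne_zero h2pi, ← exp_add, ← exp_add]
      congr 1
      ring
    · have : ∀ n, barnesLogFactor n x =
          ((((n : ℝ) + 1) * Real.log (1 + x / ((n : ℝ) + 1)) - x +
            x ^ 2 / (2 * ((n : ℝ) + 1)) : ℝ) : ℂ) := by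
        intro n
        rw [barnesLogFactor, log_one_add_ofReal_div hx]
        push_cast
        rfl
      have hl : log (2 * (Real.pi : ℂ)) = ((Real.log (2 * Real.pi) : ℝ) : ℂ) := by
        rw [ofReal_log (by positivity)]
        push_cast
        rfl
      simp only [this, ← ofReal_tsum, hl]
      norm_cast
  exact isLogBranch_logBarnesG.eqOn h hz

/-! ### The remainder of order one as a limit of Euler–Maclaurin errors -/

theorem tendsto_log_factorial :
    Tendsto (fun M : ℕ => ((Real.log (M.factorial : ℝ) : ℝ) : ℂ) - ((M : ℂ) + 1 / 2) * log (M : ℂ) + M)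
      atTop (𝓝 (log (2 * (Real.pi : ℂ)) / 2)) := by
  have hpi : (0 : ℝ) < √Real.pi := Real.sqrt_pos.2 Real.pi_pos
  have h := (Stirling.tendsto_stirlingSeq_sqrt_pi.log hpi.ne').add_const (Real.log 2 / 2)
  have h' : Tendsto (fun M : ℕ => Real.log (M.factorial : ℝ) - ((M : ℝ) + 1 / 2) * Real.log M + M)
      atTop (𝓝 (Real.log (2 * Real.pi) / 2)) := by
    have e : Real.log (√Real.pi) + Real.log 2 / 2 = Real.log (2 * Real.pi) / 2 := by
      rw [Real.log_sqrt Real.pi_pos.le, Real.log_mul two_ne_zero Real.pi_ne_zero]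
      ring
    rw [← e]
    refine h.congr' ?_
    filter_upwards [eventually_ne_atTop 0] with M hM
    have hM' : (M : ℝ) ≠ 0 := by exact_mod_cast hM
    rw [Stirling.log_stirlingSeq_formula, Real.log_mul two_ne_zero hM',
      Real.log_div hM' (Real.exp_ne_zero 1), Real.log_exp]
    ring
  have h2 := (continuous_ofReal.tendsto _).comp h'
  have hl : log (2 * (Real.pi : ℂ)) / 2 = ((Real.log (2 * Real.pi) / 2 : ℝ) : ℂ) := by
    rw [ofReal_div, ofReal_log (by positivity)]
    push_cast
    rfl
  rw [hl]
  refine h2.congr fun M => ?_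
  simp [natCast_log]

theorem tendsto_inv_natCast_add_one : Tendsto (fun M : ℕ => 1 / ((M : ℂ) + 1)) atTop (𝓝 0) := by
  have := (continuous_ofReal.tendsto _).comp (tendsto_one_div_add_atTop_nhds_zero_nat (𝕜 := ℝ))
  simpa [Function.comp_def] using this

/-- `log (1 + z / X) = z / X - z² / (2 X²) + o(X⁻²)` for `X = M + 1`. -/
theorem tendsto_natCast_mul_barnesLogFactor (z : ℂ) :
    Tendsto (fun M : ℕ => ((M : ℂ) + 1) * barnesLogFactor M z) atTop (𝓝 0) := by
  have h := (tendsto_one_div_add_atTop_nhds_zero_nat (𝕜 := ℝ)).const_mul (‖z‖ ^ 3)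
  rw [mul_zero] at h
  refine squeeze_zero_norm' ?_ h
  obtain ⟨k, hk⟩ := exists_nat_ge (2 * ‖z‖)
  filter_upwards [eventually_ge_atTop k] with M hM
  have hM' : (k : ℝ) ≤ M := by exact_mod_cast hM
  have hb := norm_barnesLogFactor_le (R := ‖z‖) (n := M) (by linarith) (z := z) le_rfl
  have hpos : (0 : ℝ) < (M : ℝ) + 1 := by positivity
  rw [norm_mul, norm_natCast_add_one]
  calc ((M : ℝ) + 1) * ‖barnesLogFactor M z‖
      ≤ ((M : ℝ) + 1) * (‖z‖ ^ 3 * (1 / ((M : ℝ) + 1) ^ 2)) := by gcongr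
    _ = ‖z‖ ^ 3 * (1 / ((M : ℝ) + 1)) := by field_simp

theorem log_natCast_add_one_add {z : ℂ} (hz : z ∈ slitPlane) (n : ℕ) :
    log (z + ((n : ℂ) + 1)) = log ((n : ℂ) + 1) + log (1 + z / ((n : ℂ) + 1)) := by
  have hpos : (0 : ℝ) < (n : ℝ) + 1 := by positivity
  have h0 := Nat.cast_add_one_ne_zero (R := ℂ) n
  have h := log_ofReal_mul hpos (slitPlane_ne_zero (one_add_div_mem_slitPlane hz n))
  rw [log_natCast_add_one, ← h]
  congr 1
  push_cast
  field_simp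
  ring

/-- The terms left over in the comparison of the Weierstrass products with the Euler–Maclaurin sums. -/
theorem tendsto_mulLogPrimitive_sub {z : ℂ} (hz : z ∈ slitPlane) :
    Tendsto (fun M : ℕ => z ^ 2 / 2 * log (M : ℂ) + z * ((M : ℂ) + 1 / 2) * log (M : ℂ)
      - (mulLogPrimitive (z + ((M : ℂ) + 1)) - mulLogPrimitive ((M : ℂ) + 1))) atTop
      (𝓝 (-(z * (z + 1) / 2))) := by
  have h1 := tendsto_natCast_mul_barnesLogFactor z
  have h2 := tendsto_inv_natCast_add_one
  have h3 : Tendsto (fun M : ℕ => (M : ℂ) * (log ((M : ℂ) + 1) - log (M : ℂ))) atTop (𝓝 1) := by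
    have h := (continuous_ofReal.tendsto _).comp
      ((Real.tendsto_mul_log_one_add_div_atTop 1).comp (tendsto_natCast_atTop_atTop (R := ℝ)))
    rw [ofReal_one] at h
    refine h.congr' ?_
    filter_upwards [eventually_ne_atTop 0] with M hM
    have hM' : (M : ℝ) ≠ 0 := by exact_mod_cast hM
    have e : 1 + 1 / (M : ℝ) = ((M : ℝ) + 1) / M := by field_simp
    simp only [Function.comp_apply]
    rw [e, Real.log_div (by positivity) hM', log_natCast_add_one, ← natCast_log]
    push_cast
    rfl
  have h4 : Tendsto (fun M : ℕ => log ((M : ℂ) + 1) - log (M : ℂ)) atTop (𝓝 0) := by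
    have h := h3.mul (tendsto_inv_atTop_nhds_zero_nat (𝕜 := ℂ))
    rw [mul_zero] at h
    refine h.congr' ?_
    filter_upwards [eventually_ne_atTop 0] with M hM
    have hM' : (M : ℂ) ≠ 0 := by exact_mod_cast hM
    field_simp
  -- with `X = M + 1`: `log (1 + z / X) → 0` and `X log (1 + z / X) → z`
  have h5 : Tendsto (fun M : ℕ => log (1 + z / ((M : ℂ) + 1))) atTop (𝓝 0) := by
    have h := (h2.mul (((h2.mul h1)).add_const z)).sub ((h2.pow 2).mul_const (z ^ 2 / 2))
    simp only [mul_zero, zero_add, zero_mul, ne_eq, OfNat.ofNat_ne_zero, not_false_eq_true,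
      zero_pow, sub_zero] at h
    refine h.congr fun M => ?_
    have h0 := Nat.cast_add_one_ne_zero (R := ℂ) M
    rw [barnesLogFactor]
    field_simp
    ring
  have h6 : Tendsto (fun M : ℕ => ((M : ℂ) + 1) * log (1 + z / ((M : ℂ) + 1))) atTop (𝓝 z) := by
    have h := ((h2.mul h1).add_const z).sub (h2.mul_const (z ^ 2 / 2))
    simp only [mul_zero, zero_add, zero_mul, sub_zero] at h
    refine h.congr fun M => ?_
    have h0 := Nat.cast_add_one_ne_zero (R := ℂ) M
    rw [barnesLogFactor]
    field_simp
    ring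
  have h := ((((((h3.const_mul (-z)).add (h4.const_mul (-(z / 2 + z ^ 2 / 2)))).sub
    (h1.div_const 2)).sub (h6.const_mul z)).sub (h5.const_mul (z ^ 2 / 2))).add
    (h6.div_const 2)).add ((h5.const_mul (z / 2 - 1 / 12)).add_const (z ^ 2 / 2))
  convert h using 1
  · ext M
    have h0 := Nat.cast_add_one_ne_zero (R := ℂ) M
    rw [mulLogPrimitive, mulLogPrimitive, log_natCast_add_one_add hz, barnesLogFactor]
    field_simp
    ring
  · congr 1
    ring

theorem sum_mul_log_eq (w : ℂ) (M : ℕ) :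
    ∑ n ∈ Finset.range M, (w + n) * log (w + n) =
      mulLogPrimitive (w + M) - mulLogPrimitive w + ∑ n ∈ Finset.range M, mulLogCell (w + n) := by
  induction M with
  | zero => simp
  | succ M ih =>
    have e : w + ((M + 1 : ℕ) : ℂ) = w + M + 1 := by
      push_cast
      ring
    rw [Finset.sum_range_succ, Finset.sum_range_succ, ih, mulLogCell, e]
    ring

theorem log_factorial_eq_sum (M : ℕ) :
    ((Real.log (M.factorial : ℝ) : ℝ) : ℂ) = ∑ n ∈ Finset.range M, log ((n : ℂ) + 1) := by
  induction M with
  | zero => simp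
  | succ M ih =>
    rw [Finset.sum_range_succ, ← ih, Nat.factorial_succ, log_natCast_add_one]
    push_cast
    rw [Real.log_mul (by positivity) (by positivity)]
    push_cast
    ring

/-- Up to elementary terms, `log G(z + 1) - z log Γ(z + 1)` is `∑ f(z + n) - ∑ f(n)` with
`f w = w log w`. Euler–Maclaurin summation of the first sum produces the errors `mulLogCell (z + n)`
and of the second the Glaisher–Kinkelin constant; Stirling's formula and the limit defining `γ`
account for the rest. -/
theorem tendsto_sum_mulLogCell {z : ℂ} (hz : z ∈ slitPlane) :
    Tendsto (fun M : ℕ => ∑ n ∈ Finset.range M, mulLogCell (z + n)) atTop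
      (𝓝 (barnesRemainder 1 z)) := by
  refine (tendsto_add_atTop_iff_nat 1).1 ?_
  have hS := (summable_barnesLogFactor z).hasSum.tendsto_sum_nat
  have hS' := (summable_gammaLogFactor z).hasSum.tendsto_sum_nat.const_mul z
  have hA := hasSum_mulLogCell_glaisherA.tendsto_sum_nat
  have hH := tendsto_harmonic_sub_log_complex.const_mul (z ^ 2 / 2)
  have hF := tendsto_log_factorial.const_mul z
  have hT := tendsto_mulLogPrimitive_sub hz
  have h := (((((hS.add hS').add hA).add hH).add hF).add hT).add_const
    (mulLogPrimitive z + z * log z + 1 / 4)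
  convert h using 1
  · ext M
    have e1 : ∑ n ∈ Finset.range (M + 1), mulLogCell (z + n) =
        ∑ n ∈ Finset.range (M + 1), (z + n) * log (z + n)
          - (mulLogPrimitive (z + (M + 1 : ℕ)) - mulLogPrimitive z) := by
      rw [sum_mul_log_eq]
      ring
    have e2 : ∑ n ∈ Finset.range M, mulLogCell ((n : ℂ) + 1) =
        ∑ n ∈ Finset.range M, ((n : ℂ) + 1) * log ((n : ℂ) + 1)
          - (mulLogPrimitive ((M : ℂ) + 1) + 1 / 4) := by
      have := sum_mul_log_eq 1 M
      simp only [add_comm (1 : ℂ)] at this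
      rw [this, mulLogPrimitive, mulLogPrimitive, log_one]
      ring
    have e3 : (harmonic M : ℂ) = ∑ n ∈ Finset.range M, 1 / ((n : ℂ) + 1) := by
      rw [harmonic]
      push_cast
      simp
    have e4 : ∑ n ∈ Finset.range M, (z + ((n + 1 : ℕ) : ℂ)) * log (z + ((n + 1 : ℕ) : ℂ)) =
        ∑ n ∈ Finset.range M, barnesLogFactor n z + z * ∑ n ∈ Finset.range M, gammaLogFactor n z
        + ∑ n ∈ Finset.range M, ((n : ℂ) + 1) * log ((n : ℂ) + 1)
        + z * ∑ n ∈ Finset.range M, log ((n : ℂ) + 1)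
        + z ^ 2 / 2 * ∑ n ∈ Finset.range M, 1 / ((n : ℂ) + 1) + M * z := by
      have : (M : ℂ) * z = ∑ n ∈ Finset.range M, z := by simp
      rw [this, Finset.mul_sum, Finset.mul_sum, Finset.mul_sum, ← Finset.sum_add_distrib,
        ← Finset.sum_add_distrib, ← Finset.sum_add_distrib, ← Finset.sum_add_distrib,
        ← Finset.sum_add_distrib]
      refine Finset.sum_congr rfl fun n _ => ?_
      have h0 := Nat.cast_add_one_ne_zero (R := ℂ) n
      push_cast
      rw [log_natCast_add_one_add hz, barnesLogFactor, gammaLogFactor]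
      field_simp
      ring
    rw [e1, e2, e3, log_factorial_eq_sum, Finset.sum_range_succ', e4]
    push_cast
    simp only [add_zero]
    ring
  · rw [barnesRemainder, logBarnesGAddOne_eq hz, logGammaAddOne_eq hz, mulLogPrimitive]
    simp only [Finset.Ico_self, Finset.sum_empty]
    congr 1
    ring

/-! ### Laplace transforms along rotated rays -/

open MeasureTheory in
theorem integrableOn_pow_mul_exp_neg_mul {r : ℝ} (hr : 0 < r) (n : ℕ) :
    IntegrableOn (fun s : ℝ => s ^ n * Real.exp (-(r * s))) (Ioi 0) := by
  have h := integrableOn_rpow_mul_exp_neg_mul_rpow (p := 1) (s := n) (b := r)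
    (by have : (0 : ℝ) ≤ n := Nat.cast_nonneg n
        linarith) one_pos hr
  refine h.congr_fun (fun s _ => ?_) measurableSet_Ioi
  simp

open MeasureTheory in
theorem integral_pow_mul_exp_neg_mul {r : ℝ} (hr : 0 < r) (n : ℕ) :
    ∫ s in Ioi (0 : ℝ), s ^ n * Real.exp (-(r * s)) = n.factorial / r ^ (n + 1) := by
  have h := Real.integral_rpow_mul_exp_neg_mul_Ioi (a := n + 1) (r := r) (by positivity) hr
  rw [Real.Gamma_nat_eq_factorial] at h
  have e : ((n : ℝ) + 1) = ((n + 1 : ℕ) : ℝ) := by push_cast; rfl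
  rw [e, Real.rpow_natCast] at h
  rw [one_div, inv_pow, inv_mul_eq_div] at h
  rw [← h]
  refine setIntegral_congr_fun measurableSet_Ioi fun s _ => ?_
  simp

theorem norm_exp_neg_mul_ofReal (r : ℂ) (s : ℝ) : ‖exp (-(r * s))‖ = Real.exp (-(r.re * s)) := by
  rw [norm_exp]
  simp

open MeasureTheory in
theorem integrableOn_pow_mul_cexp_neg_mul {r : ℂ} (hr : 0 < r.re) (n : ℕ) :
    IntegrableOn (fun s : ℝ => (s : ℂ) ^ n * exp (-(r * s))) (Ioi 0) := by
  refine (integrableOn_pow_mul_exp_neg_mul hr n).mono'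
    (by fun_prop : Continuous fun s : ℝ => (s : ℂ) ^ n * exp (-(r * s))).aestronglyMeasurable ?_
  refine (ae_restrict_iff' measurableSet_Ioi).2 (ae_of_all _ fun s hs => ?_)
  rw [norm_mul, norm_pow, norm_real, Real.norm_of_nonneg (le_of_lt hs), norm_exp_neg_mul_ofReal]

open MeasureTheory in
theorem integral_pow_mul_cexp_neg_mul {r : ℂ} (hr : 0 < r.re) (n : ℕ) :
    ∫ s in Ioi (0 : ℝ), (s : ℂ) ^ n * exp (-(r * s)) = n.factorial / r ^ (n + 1) := by
  have hr0 : r ≠ 0 := by rintro rfl; simp at hr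
  induction n with
  | zero =>
    have h := integral_exp_mul_complex_Ioi (a := -r) (by simpa using hr) 0
    simp only [neg_mul] at h
    simp [h]
  | succ n ih =>
    have hlim : Tendsto (fun s : ℝ => (s : ℂ) ^ (n + 1) * exp (-(r * s))) atTop (𝓝 0) := by
      rw [tendsto_zero_iff_norm_tendsto_zero]
      have h := (isLittleO_pow_exp_pos_mul_atTop (n + 1) hr).tendsto_div_nhds_zero
      refine h.congr' ?_
      filter_upwards [eventually_ge_atTop 0] with s hs
      rw [norm_mul, norm_pow, norm_real, Real.norm_of_nonneg hs, norm_exp_neg_mul_ofReal,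
        Real.exp_neg, div_eq_mul_inv]
    have hd : ∀ s : ℝ, HasDerivAt (fun s : ℝ => (s : ℂ) ^ (n + 1) * exp (-(r * s)))
        ((n + 1) * ((s : ℂ) ^ n * exp (-(r * s))) - r * ((s : ℂ) ^ (n + 1) * exp (-(r * s)))) s := by
      intro s
      have hid : HasDerivAt (fun x : ℝ => (x : ℂ)) 1 s := (hasDerivAt_id s).ofReal_comp
      refine ((hid.fun_pow (n + 1)).mul ((hid.const_mul r).neg.cexp)).congr_deriv ?_
      simp only [Pi.neg_apply]
      push_cast
      ring
    have hi1 := (integrableOn_pow_mul_cexp_neg_mul hr n).const_mul ((n : ℂ) + 1)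
    have hi2 := (integrableOn_pow_mul_cexp_neg_mul hr (n + 1)).const_mul r
    have h := integral_Ioi_of_hasDerivAt_of_tendsto (hd 0).continuousAt.continuousWithinAt
      (fun s _ => hd s) (hi1.sub hi2) hlim
    rw [integral_sub hi1 hi2, integral_const_mul, integral_const_mul, ih] at h
    have h' : r * ∫ s in Ioi (0 : ℝ), (s : ℂ) ^ (n + 1) * exp (-(r * s)) =
        (n + 1) * (n.factorial / r ^ (n + 1)) := by
      simp only [ofReal_zero, ne_eq, Nat.add_eq_zero_iff, one_ne_zero, and_false, not_false_eq_true,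
        zero_pow, zero_mul, sub_zero] at h
      linear_combination -h
    rw [eq_div_iff (pow_ne_zero _ hr0), pow_succ r (n + 1), Nat.factorial_succ]
    have h3 : r ^ (n + 1) ≠ 0 := pow_ne_zero _ hr0
    have h4 : r * ∫ s in Ioi (0 : ℝ), (s : ℂ) ^ (n + 1) * exp (-(r * s)) =
        ((n + 1) * n.factorial) / r ^ (n + 1) := by rw [h']; ring
    rw [eq_div_iff h3] at h4
    push_cast
    linear_combination h4

theorem sq_add_sq_ne_zero {r : ℂ} (hr : 0 < r.re) (a : ℝ) : r ^ 2 + (a : ℂ) ^ 2 ≠ 0 := by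
  have e : r ^ 2 + (a : ℂ) ^ 2 = (r - a * I) * (r + a * I) := by
    ring_nf
    rw [I_sq]
    ring
  rw [e]
  refine mul_ne_zero (fun h => ?_) (fun h => ?_)
  · have := congrArg re h
    simp at this
    linarith
  · have := congrArg re h
    simp at this
    linarith

open MeasureTheory in
theorem integral_one_sub_cos_mul_cexp {r : ℂ} (hr : 0 < r.re) (a : ℝ) :
    ∫ x in Ioi (0 : ℝ), ((1 - Real.cos (a * x) : ℝ) : ℂ) * exp (-(r * x)) =
      (a : ℂ) ^ 2 / (r * (r ^ 2 + (a : ℂ) ^ 2)) := by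
  have hr0 : r ≠ 0 := by rintro rfl; simp at hr
  have h1 : 0 < (r - a * I).re := by simpa using hr
  have h2 : 0 < (r + a * I).re := by simpa using hr
  have hi0 := integrableOn_pow_mul_cexp_neg_mul hr 0
  have hi1 := (integrableOn_pow_mul_cexp_neg_mul h1 0).const_mul (1 / 2)
  have hi2 := (integrableOn_pow_mul_cexp_neg_mul h2 0).const_mul (1 / 2)
  have e : ∀ x : ℝ, ((1 - Real.cos (a * x) : ℝ) : ℂ) * exp (-(r * x)) =
      (x : ℂ) ^ 0 * exp (-(r * x)) - 1 / 2 * ((x : ℂ) ^ 0 * exp (-((r - a * I) * x)))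
        - 1 / 2 * ((x : ℂ) ^ 0 * exp (-((r + a * I) * x))) := by
    intro x
    have e1 : exp (-((r - a * I) * x)) = exp (-(r * x)) * exp (a * x * I) := by
      rw [← exp_add]
      ring_nf
    have e2 : exp (-((r + a * I) * x)) = exp (-(r * x)) * exp (-(a * x) * I) := by
      rw [← exp_add]
      ring_nf
    rw [e1, e2]
    push_cast
    rw [Complex.cos]
    ring
  simp only [e]
  have hsub := integral_sub (hi0.sub hi1) hi2
  simp only [Pi.sub_apply] at hsub
  rw [hsub, integral_sub hi0 hi1, integral_const_mul, integral_const_mul,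
    integral_pow_mul_cexp_neg_mul hr, integral_pow_mul_cexp_neg_mul h1,
    integral_pow_mul_cexp_neg_mul h2]
  have h1' : r - a * I ≠ 0 := by intro h; rw [h] at h1; simp at h1
  have h2' : r + a * I ≠ 0 := by intro h; rw [h] at h2; simp at h2
  have h3 := sq_add_sq_ne_zero hr a
  simp only [zero_add, pow_one, Nat.factorial_zero, Nat.cast_one]
  field_simp
  ring_nf
  simp only [I_sq]
  ring

/-- Conversely, `α = exp (-i arg z / 2)` satisfies the hypotheses for every `z` in the slit plane. -/
theorem mem_slitPlane_of_re_pos {α z : ℂ} (hα : 0 < α.re) (hαz : 0 < (α * z).re) :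
    z ∈ slitPlane := by
  rw [mem_slitPlane_iff_not_le_zero]
  intro h
  obtain ⟨h1, h2⟩ := Complex.le_def.1 h
  simp only [mul_re, zero_re, zero_im] at *
  rw [h2] at hαz
  nlinarith

theorem re_mul_add_ofReal (α z : ℂ) (x : ℝ) : (α * (z + x)).re = (α * z).re + α.re * x := by
  simp
  ring

theorem re_mul_add_ofReal_pos {α z : ℂ} (hα : 0 < α.re) (hαz : 0 < (α * z).re) {x : ℝ}
    (hx : 0 ≤ x) : 0 < (α * (z + x)).re := by
  rw [re_mul_add_ofReal]
  positivity

open MeasureTheory in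
/-- The integrand decays because `‖α‖ ‖z + x‖ ≥ Re (α (z + x))` grows linearly in `x`. -/
theorem integrableOn_inv_cube {α z : ℂ} (hα : 0 < α.re) (hαz : 0 < (α * z).re) :
    IntegrableOn (fun x : ℝ => 1 / (z + x) ^ 3) (Ioi 0) := by
  have hz : ∀ x : ℝ, 0 ≤ x → z + x ≠ 0 := fun x hx => slitPlane_ne_zero
    (add_nonneg_mem_slitPlane (mem_slitPlane_of_re_pos hα hαz) hx)
  set c := min α.re (α * z).re with hc
  have hc0 : 0 < c := lt_min hα hαz
  have hα0 : 0 < ‖α‖ := norm_pos_iff.2 (by rintro rfl; simp at hα)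
  have hint := (integrableOn_add_rpow_Ioi_of_lt (a := -3) (c := 0) (m := 1) (by norm_num)
    (by norm_num)).const_mul ((‖α‖ / c) ^ 3)
  refine Integrable.mono' hint ?_ ?_
  · refine ContinuousOn.aestronglyMeasurable ?_ measurableSet_Ioi
    exact continuousOn_const.div (by fun_prop) fun x hx => pow_ne_zero _ (hz x (le_of_lt hx))
  · refine (ae_restrict_iff' measurableSet_Ioi).2 (ae_of_all _ fun x hx => ?_)
    have hx0 : (0 : ℝ) < x := hx
    have h1 : c * (x + 1) ≤ ‖α‖ * ‖z + x‖ := by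
      rw [← norm_mul]
      refine le_trans ?_ (re_le_norm _)
      rw [re_mul_add_ofReal]
      nlinarith [min_le_left α.re (α * z).re, min_le_right α.re (α * z).re]
    have h2 : 0 < ‖z + x‖ := norm_pos_iff.2 (hz x hx0.le)
    have h3 : 1 / ‖z + x‖ ≤ ‖α‖ / c * (1 / (x + 1)) := by
      rw [div_mul_div_comm, mul_one, div_le_div_iff₀ h2 (by positivity)]
      linarith
    have e : (x + 1) ^ (-3 : ℝ) = (1 / (x + 1)) ^ 3 := by
      rw [Real.rpow_neg (by positivity), one_div, inv_pow]
      norm_num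
    rw [e, ← mul_pow, norm_div, norm_one, norm_pow, ← one_div_pow]
    gcongr

open MeasureTheory in
/-- Both sides are the integral of `(1 - cos a x) (α s)² e^{-α s (z + x)} α` over the quadrant
`x, s > 0`. No contour has to be rotated: the right side may be taken along any ray `α s` on which
`e^{-α s}` and `e^{-α s z}` decay. -/
theorem integral_one_sub_cos_div_cube {α z : ℂ} (hα : 0 < α.re) (hαz : 0 < (α * z).re) {a : ℝ}
    (ha : 0 < a) :
    ∫ x in Ioi (0 : ℝ), ((1 - Real.cos (a * x) : ℝ) : ℂ) * (1 / (z + x) ^ 3) =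
      1 / 2 * ∫ s in Ioi (0 : ℝ), α * ((α * s) ^ 1 * exp (-(α * s * z)) / (1 + (α * s / a) ^ 2)) := by
  have hα0 : α ≠ 0 := by rintro rfl; simp at hα
  have hz : ∀ x : ℝ, 0 ≤ x → z + x ≠ 0 := fun x hx => slitPlane_ne_zero
    (add_nonneg_mem_slitPlane (mem_slitPlane_of_re_pos hα hαz) hx)
  let f : ℝ → ℝ → ℂ := fun s x =>
    ((1 - Real.cos (a * x) : ℝ) : ℂ) * (α ^ 3 * ((s : ℂ) ^ 2 * exp (-(α * (z + x) * s))))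
  have hint : Integrable (Function.uncurry f)
      ((volume.restrict (Ioi 0)).prod (volume.restrict (Ioi 0))) := by
    let g : ℝ × ℝ → ℝ := fun q =>
      (q.1 ^ 2 * Real.exp (-((α * z).re * q.1))) * Real.exp (-(α.re * q.1 * q.2))
    have hxint : ∀ s : ℝ, 0 < s → IntegrableOn (fun x => Real.exp (-(α.re * s * x))) (Ioi 0) := by
      intro s hs
      simpa using integrableOn_pow_mul_exp_neg_mul (mul_pos hα hs) 0
    have hg : Integrable g ((volume.restrict (Ioi 0)).prod (volume.restrict (Ioi 0))) := by
      have hgc : Continuous g := by fun_prop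
      rw [integrable_prod_iff hgc.aestronglyMeasurable]
      refine ⟨(ae_restrict_iff' measurableSet_Ioi).2 (ae_of_all _ fun s hs => ?_), ?_⟩
      · exact Integrable.const_mul (hxint s hs) (s ^ 2 * Real.exp (-((α * z).re * s)))
      · have h := (integrableOn_pow_mul_exp_neg_mul hαz 1).const_mul (1 / α.re)
        refine IntegrableOn.congr_fun h (fun s hs => ?_) measurableSet_Ioi
        have hs0 : (0 : ℝ) < s := hs
        have e : ∀ x, ‖g (s, x)‖ =
            (s ^ 2 * Real.exp (-((α * z).re * s))) * Real.exp (-(α.re * s * x)) := fun x =>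
          Real.norm_of_nonneg (by positivity)
        simp only [e]
        rw [integral_const_mul]
        have h0 := integral_pow_mul_exp_neg_mul (mul_pos hα hs0) 0
        simp only [pow_zero, one_mul, zero_add, pow_one, Nat.factorial_zero, Nat.cast_one] at h0
        rw [h0]
        field_simp
    refine (hg.const_mul (2 * ‖α‖ ^ 3)).mono' ?_ ?_
    · exact (by fun_prop : Continuous (Function.uncurry f)).aestronglyMeasurable
    · refine ae_of_all _ fun q => ?_
      obtain ⟨s, x⟩ := q
      simp only [Function.uncurry_apply_pair, f, g]
      have h1 : ‖((1 - Real.cos (a * x) : ℝ) : ℂ)‖ ≤ 2 := by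
        rw [norm_real, Real.norm_eq_abs, abs_le]
        constructor <;> linarith [Real.cos_le_one (a * x), Real.neg_one_le_cos (a * x)]
      rw [norm_mul, norm_mul, norm_mul, norm_pow, norm_pow, norm_real s, Real.norm_eq_abs, sq_abs,
        norm_exp_neg_mul_ofReal, re_mul_add_ofReal, mul_assoc 2, mul_assoc (s ^ 2), ← Real.exp_add,
        show -((α * z).re * s) + -(α.re * s * x) = -(((α * z).re + α.re * x) * s) by ring]
      gcongr
  have hswap := integral_integral_swap hint
  have hleft : ∫ s in Ioi (0 : ℝ), ∫ x in Ioi (0 : ℝ), f s x =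
      ∫ s in Ioi (0 : ℝ), α * ((α * s) ^ 1 * exp (-(α * s * z)) / (1 + (α * s / a) ^ 2)) := by
    refine setIntegral_congr_fun measurableSet_Ioi fun s hs => ?_
    have hs0 : (0 : ℝ) < s := hs
    have hre : 0 < (α * s).re := by simpa using mul_pos hα hs0
    have e : ∀ x : ℝ, f s x = (α ^ 3 * (s : ℂ) ^ 2 * exp (-(α * s * z))) *
        (((1 - Real.cos (a * x) : ℝ) : ℂ) * exp (-(α * s * x))) := by
      intro x
      simp only [f]
      rw [show -(α * (z + x) * s) = -(α * s * z) + -(α * s * x) by ring, exp_add]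
      ring
    simp only [e]
    rw [integral_const_mul, integral_one_sub_cos_mul_cexp hre]
    have hs' : (s : ℂ) ≠ 0 := by exact_mod_cast hs0.ne'
    have ha' : (a : ℂ) ≠ 0 := by exact_mod_cast ha.ne'
    have h1 := sq_add_sq_ne_zero hre a
    have h2 : 1 + (α * s / a) ^ 2 = ((α * s) ^ 2 + (a : ℂ) ^ 2) / a ^ 2 := by
      field_simp
      ring
    rw [h2]
    field_simp
  have hright : ∫ x in Ioi (0 : ℝ), ∫ s in Ioi (0 : ℝ), f s x =
      2 * ∫ x in Ioi (0 : ℝ), ((1 - Real.cos (a * x) : ℝ) : ℂ) * (1 / (z + x) ^ 3) := by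
    rw [← integral_const_mul]
    refine setIntegral_congr_fun measurableSet_Ioi fun x hx => ?_
    have hx0 : (0 : ℝ) < x := hx
    simp only [f]
    rw [integral_const_mul, integral_const_mul,
      integral_pow_mul_cexp_neg_mul (re_mul_add_ofReal_pos hα hαz hx0.le), mul_pow]
    have h1 := hz x hx0.le
    norm_num
    field_simp
  rw [hleft, hright] at hswap
  rw [hswap]
  ring

/-! ### The remainders as sums of Laplace integrals -/

theorem eval_bernoulli_four (x : ℝ) :
    (Polynomial.map (algebraMap ℚ ℝ) (Polynomial.bernoulli 4)).eval x =
      x ^ 2 * (1 - x) ^ 2 - 1 / 30 := by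
  have h4 : bernoulli 4 = -1 / 30 := by
    rw [bernoulli_eq_bernoulli'_of_ne_one (by norm_num), bernoulli'_four]
  have h3 : bernoulli 3 = 0 := by
    rw [bernoulli_eq_bernoulli'_of_ne_one (by norm_num), bernoulli'_three]
  have h2 : bernoulli 2 = 1 / 6 := by
    rw [bernoulli_eq_bernoulli'_of_ne_one (by norm_num), bernoulli'_two]
  simp only [Polynomial.bernoulli, Finset.sum_range_succ, Finset.sum_range_zero, zero_add,
    Polynomial.map_add, Polynomial.map_monomial, Polynomial.eval_add, Polynomial.eval_monomial]
  norm_num [h2, h3, h4, bernoulli_one, Nat.choose]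
  ring

/-- The frequency `2π(k + 1)` of the `k`-th Fourier mode; the shift keeps it positive for all `k`. -/
noncomputable def fourierFreq (k : ℕ) : ℝ := 2 * Real.pi * ((k : ℝ) + 1)

theorem fourierFreq_pos (k : ℕ) : 0 < fourierFreq k := by
  unfold fourierFreq
  positivity

/-- The Fourier series of the kernel `B₄(x) - B₄`. -/
theorem hasSum_one_sub_cos {x : ℝ} (hx : x ∈ Icc (0 : ℝ) 1) :
    HasSum (fun k : ℕ => 48 / fourierFreq k ^ 4 * (1 - Real.cos (fourierFreq k * x)))
      (x ^ 2 * (1 - x) ^ 2) := by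
  have h0 := hasSum_one_div_nat_pow_mul_cos two_ne_zero (x := 0) ⟨le_rfl, zero_le_one⟩
  have h1 := hasSum_one_div_nat_pow_mul_cos two_ne_zero hx
  have h := (h0.sub h1).mul_left (48 / (2 * Real.pi) ^ 4)
  rw [show 2 * 2 = 4 by norm_num, eval_bernoulli_four, eval_bernoulli_four] at h
  rw [← hasSum_nat_add_iff' 1] at h
  have hv : 48 / (2 * Real.pi) ^ 4 *
      ((-1) ^ (2 + 1) * (2 * Real.pi) ^ 4 / 2 / (Nat.factorial 4 : ℝ) *
          (0 ^ 2 * (1 - 0) ^ 2 - 1 / 30) -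
        (-1) ^ (2 + 1) * (2 * Real.pi) ^ 4 / 2 / (Nat.factorial 4 : ℝ) *
          (x ^ 2 * (1 - x) ^ 2 - 1 / 30)) -
      ∑ i ∈ Finset.range 1, 48 / (2 * Real.pi) ^ 4 *
        (1 / (i : ℝ) ^ 4 * Real.cos (2 * Real.pi * i * 0) -
          1 / (i : ℝ) ^ 4 * Real.cos (2 * Real.pi * i * x)) = x ^ 2 * (1 - x) ^ 2 := by
    have := Real.pi_ne_zero
    simp [Nat.factorial]
    field_simp
    ring
  rw [hv] at h
  refine h.congr_fun fun k => ?_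
  rw [mul_zero, Real.cos_zero, fourierFreq]
  push_cast
  have := Real.pi_ne_zero
  field_simp

theorem summable_fourierFreq_inv_pow (C : ℝ) :
    Summable fun k : ℕ => C / fourierFreq k ^ 4 := by
  have h := (summable_nat_add_iff 1).2 (Real.summable_one_div_nat_pow.2 (by norm_num : 1 < 4))
  have h' := h.mul_left (C / (2 * Real.pi) ^ 4)
  refine h'.congr fun k => ?_
  rw [fourierFreq]
  push_cast
  field_simp

theorem cos_fourierFreq_add_natCast (k n : ℕ) (x : ℝ) :
    Real.cos (fourierFreq k * (x + n)) = Real.cos (fourierFreq k * x) := by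
  rw [show fourierFreq k * (x + n) = fourierFreq k * x + ((n * (k + 1) : ℕ) : ℝ) * (2 * Real.pi) by
    rw [fourierFreq]; push_cast; ring]
  exact Real.cos_add_nat_mul_two_pi _ _

open MeasureTheory in
/-- The cells fit together to an integral over `(0, ∞)`, as the Fourier series continues the kernel
periodically. -/
theorem hasSum_barnesRemainder_one_cos {α z : ℂ} (hα : 0 < α.re) (hαz : 0 < (α * z).re) :
    HasSum (fun k : ℕ => ∫ x in Ioi (0 : ℝ), (-(4 / fourierFreq k ^ 4) : ℝ) *
        (((1 - Real.cos (fourierFreq k * x) : ℝ) : ℂ) * (1 / (z + x) ^ 3)))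
      (barnesRemainder 1 z) := by
  have hz := mem_slitPlane_of_re_pos hα hαz
  let F : ℕ → ℝ → ℂ := fun k x => (-(4 / fourierFreq k ^ 4) : ℝ) *
        (((1 - Real.cos (fourierFreq k * x) : ℝ) : ℂ) * (1 / (z + x) ^ 3))
  let K : ℝ → ℂ := fun x => 1 / (z + x) ^ 3
  have hK : IntegrableOn K (Ioi 0) := integrableOn_inv_cube hα hαz
  have hcont : ∀ k, Continuous fun x : ℝ => ((1 - Real.cos (fourierFreq k * x) : ℝ) : ℂ) := by
    intro k
    fun_prop
  have hcos : ∀ y : ℝ, ‖((1 - Real.cos y : ℝ) : ℂ)‖ ≤ 2 := by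
    intro y
    rw [norm_real, Real.norm_eq_abs, abs_le]
    constructor <;> linarith [Real.cos_le_one y, Real.neg_one_le_cos y]
  have hFb : ∀ k x, ‖F k x‖ ≤ 8 / fourierFreq k ^ 4 * ‖K x‖ := by
    intro k x
    have hp := fourierFreq_pos k
    simp only [F, K]
    rw [norm_mul, norm_mul _ (1 / (z + x) ^ 3), norm_real, norm_neg,
      Real.norm_of_nonneg (by positivity)]
    calc 4 / fourierFreq k ^ 4 * (‖((1 - Real.cos (fourierFreq k * x) : ℝ) : ℂ)‖ * ‖1 / (z + x) ^ 3‖)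
        ≤ 4 / fourierFreq k ^ 4 * (2 * ‖1 / (z + x) ^ 3‖) := by
          gcongr
          exact hcos _
      _ = _ := by ring
  have hFi : ∀ k, Integrable (F k) (volume.restrict (Ioi 0)) := by
    intro k
    refine Integrable.mono' (hK.norm.const_mul (8 / fourierFreq k ^ 4)) ?_
      (ae_of_all _ (hFb k))
    exact ((hcont k).aestronglyMeasurable.mul hK.aestronglyMeasurable).const_mul _
  have hsum := hasSum_integral_of_summable_integral_norm hFi (by
    refine Summable.of_nonneg_of_le (fun k => integral_nonneg fun x => norm_nonneg _) (fun k => ?_)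
      ((summable_fourierFreq_inv_pow 8).mul_right (∫ x in Ioi (0 : ℝ), ‖K x‖))
    rw [← integral_const_mul]
    exact integral_mono (hFi k).norm (hK.norm.const_mul _) (hFb k))
  have hgoal : ∫ x in Ioi (0 : ℝ), ∑' k, F k x = barnesRemainder 1 z := ?_
  · rw [hgoal] at hsum
    exact hsum
  have hSum : ∀ x, Summable fun k => F k x := fun x =>
    Summable.of_norm_bounded ((summable_fourierFreq_inv_pow 8).mul_right ‖K x‖) (hFb · x)
  have hInt : IntegrableOn (fun x => ∑' k, F k x) (Ioi 0) := by
    refine Integrable.mono' (hK.norm.const_mul (∑' k, 8 / fourierFreq k ^ 4)) ?_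
      (ae_of_all _ fun x => ?_)
    · have hm := aestronglyMeasurable_of_tendsto_ae (μ := volume.restrict (Ioi 0)) atTop
        (f := fun n x => ∑ k ∈ Finset.range n, F k x) (g := fun x => ∑' k, F k x)
        (fun n => (integrable_finsetSum _ fun k _ => hFi k).aestronglyMeasurable)
        (ae_of_all _ fun x => (hSum x).hasSum.tendsto_sum_nat)
      exact hm
    · rw [← tsum_mul_right]
      exact tsum_of_norm_bounded ((summable_fourierFreq_inv_pow 8).mul_right ‖K x‖).hasSum (hFb · x)
  have hcell : ∀ n : ℕ, mulLogCell (z + n) = ∫ x in (n : ℝ)..((n + 1 : ℕ) : ℝ), ∑' k, F k x := by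
    intro n
    have h1 := intervalIntegral.integral_comp_add_right (a := 0) (b := 1)
      (fun x => ∑' k, F k x) (n : ℝ)
    rw [zero_add, add_comm (1 : ℝ)] at h1
    push_cast
    have hzn : z + n ∈ slitPlane := by
      simpa using add_nonneg_mem_slitPlane hz (Nat.cast_nonneg (α := ℝ) n)
    rw [← h1, mulLogCell_eq_integral hzn, ← intervalIntegral.integral_const_mul]
    refine intervalIntegral.integral_congr fun x hx => ?_
    rw [uIcc_of_le zero_le_one] at hx
    have h2 := ((Complex.hasSum_ofReal.2 (hasSum_one_sub_cos hx)).mul_left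
      (-(1 / 12) * (1 / (z + n + x) ^ 3))).tsum_eq
    rw [show -(1 / 12) * (((x ^ 2 * (1 - x) ^ 2 : ℝ) : ℂ) * (1 / (z + n + x) ^ 3)) =
      -(1 / 12) * (1 / (z + n + x) ^ 3) * ((x ^ 2 * (1 - x) ^ 2 : ℝ) : ℂ) by ring, ← h2]
    refine tsum_congr fun k => ?_
    simp only [F]
    rw [cos_fourierFreq_add_natCast]
    push_cast
    rw [show z + (x + n) = z + n + (x : ℂ) by ring]
    ring
  have hlim := intervalIntegral_tendsto_integral_Ioi 0 hInt
    (tendsto_natCast_atTop_atTop (R := ℝ))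
  refine tendsto_nhds_unique (hlim.congr fun M => ?_) (tendsto_sum_mulLogCell hz)
  simp only [hcell]
  have hadj := intervalIntegral.sum_integral_adjacent_intervals (μ := volume)
    (f := fun x => ∑' k, F k x) (a := fun n : ℕ => (n : ℝ)) (n := M) ?_
  · rw [hadj]
    simp
  · intro n _
    rw [intervalIntegrable_iff_integrableOn_Ioc_of_le (by simp)]
    refine hInt.mono_set fun x hx => ?_
    exact lt_of_le_of_lt (Nat.cast_nonneg n) hx.1

/-- The Laplace integral `∫ (α s)^p e^{-α s z} / (1 + (α s / a)²) α ds` along the ray through `α`. -/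
noncomputable def rayIntegral (p : ℕ) (a : ℝ) (α z : ℂ) : ℂ :=
  ∫ s in Ioi (0 : ℝ), α * ((α * s) ^ p * exp (-(α * s * z)) / (1 + (α * s / a) ^ 2))

theorem hasSum_barnesRemainder_one {α z : ℂ} (hα : 0 < α.re) (hαz : 0 < (α * z).re) :
    HasSum (fun k : ℕ => (-2 / fourierFreq k ^ 4 : ℝ) * rayIntegral 1 (fourierFreq k) α z)
      (barnesRemainder 1 z) := by
  refine (hasSum_barnesRemainder_one_cos hα hαz).congr_fun fun k => ?_
  rw [MeasureTheory.integral_const_mul,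
    integral_one_sub_cos_div_cube hα hαz (fourierFreq_pos k), rayIntegral]
  push_cast
  ring

/-- `c > 0` is a lower bound of `|1 + (α s)²|` for `s ≥ 0`, where `u = s²`. -/
def IsRayBound (α : ℂ) (c : ℝ) : Prop :=
  0 < c ∧ ∀ u : ℝ, 0 ≤ u → c ≤ ‖1 + α ^ 2 * (u : ℂ)‖

theorem IsRayBound.le_norm {α : ℂ} {c : ℝ} (h : IsRayBound α c) (s a : ℝ) :
    c ≤ ‖1 + (α * s / a) ^ 2‖ := by
  have e : (α * s / a) ^ 2 = α ^ 2 * (((s / a) ^ 2 : ℝ) : ℂ) := by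
    push_cast
    ring
  rw [e]
  exact h.2 _ (sq_nonneg _)

theorem IsRayBound.ne_zero {α : ℂ} {c : ℝ} (h : IsRayBound α c) (s a : ℝ) :
    1 + (α * s / a) ^ 2 ≠ 0 :=
  norm_pos_iff.1 (h.1.trans_le (h.le_norm s a))

/-- The ray bound is `1` when `|arg α| ≤ π / 4`. -/
theorem isRayBound_one {α : ℂ} (h : 0 ≤ (α ^ 2).re) : IsRayBound α 1 := by
  refine ⟨one_pos, fun u hu => le_trans ?_ (re_le_norm _)⟩
  rw [add_re, one_re, re_mul_ofReal]
  have := mul_nonneg h hu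
  linarith

/-- The distance from the origin to the ray `1 + α² u` is at least its distance to the line. -/
theorem isRayBound_abs_im {α : ℂ} (h1 : ‖α‖ = 1) (h : (α ^ 2).im ≠ 0) :
    IsRayBound α |(α ^ 2).im| := by
  refine ⟨abs_pos.2 h, fun u _ => ?_⟩
  -- `|1 + α² u| ≥ |Im ((1 + α² u) conj (α²))|`
  have e : ((1 + α ^ 2 * (u : ℂ)) * (starRingEnd ℂ) (α ^ 2)).im = -(α ^ 2).im := by
    simp only [mul_im, add_re, add_im, one_re, one_im, mul_re, conj_re, conj_im, ofReal_re,
      ofReal_im]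
    ring
  have h2 := abs_im_le_norm ((1 + α ^ 2 * (u : ℂ)) * (starRingEnd ℂ) (α ^ 2))
  rwa [e, abs_neg, norm_mul, RCLike.norm_conj, norm_pow, h1, one_pow, mul_one] at h2

theorem exists_isRayBound {α : ℂ} (h1 : ‖α‖ = 1) (hα : 0 < α.re) : ∃ c, IsRayBound α c := by
  by_cases h : (α ^ 2).im = 0
  · refine ⟨1, isRayBound_one ?_⟩
    simp only [sq, mul_im, mul_re] at h ⊢
    have : α.im = 0 := by
      have : 2 * α.re * α.im = 0 := by linarith
      simpa [hα.ne'] using this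
    rw [this]
    nlinarith
  · exact ⟨_, isRayBound_abs_im h1 h⟩

theorem norm_rayIntegrand_le {α z : ℂ} {c : ℝ} (h1 : ‖α‖ = 1) (hc : IsRayBound α c) (p : ℕ) (a : ℝ)
    {s : ℝ} (hs : 0 < s) :
    ‖α * ((α * s) ^ p * exp (-(α * s * z)) / (1 + (α * s / a) ^ 2))‖ ≤
      1 / c * (s ^ p * Real.exp (-((α * z).re * s))) := by
  have hc0 := hc.1
  rw [norm_mul, h1, one_mul, norm_div, norm_mul, norm_pow, norm_mul, h1, one_mul, norm_real,
    Real.norm_of_nonneg hs.le, show α * s * z = α * z * s by ring, norm_exp_neg_mul_ofReal,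
    one_div_mul_eq_div]
  gcongr
  exact hc.le_norm s a

open MeasureTheory in
theorem integrableOn_rayIntegrand {α z : ℂ} {c : ℝ} (h1 : ‖α‖ = 1) (hαz : 0 < (α * z).re)
    (hc : IsRayBound α c) (p : ℕ) (a : ℝ) :
    IntegrableOn (fun s : ℝ => α * ((α * s) ^ p * exp (-(α * s * z)) / (1 + (α * s / a) ^ 2)))
      (Ioi 0) := by
  refine ((integrableOn_pow_mul_exp_neg_mul hαz p).const_mul (1 / c)).mono' ?_ ?_
  · refine Continuous.aestronglyMeasurable ?_
    exact continuous_const.mul (Continuous.div (by fun_prop) (by fun_prop) fun s => hc.ne_zero s a)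
  · exact (ae_restrict_iff' measurableSet_Ioi).2 (ae_of_all _ fun s hs =>
      norm_rayIntegrand_le h1 hc p a hs)

open MeasureTheory in
theorem norm_rayIntegral_le {α z : ℂ} {c : ℝ} (h1 : ‖α‖ = 1) (hαz : 0 < (α * z).re)
    (hc : IsRayBound α c) (p : ℕ) (a : ℝ) :
    ‖rayIntegral p a α z‖ ≤ 1 / c * (p.factorial / (α * z).re ^ (p + 1)) := by
  rw [← integral_pow_mul_exp_neg_mul hαz, ← integral_const_mul]
  exact norm_integral_le_of_norm_le ((integrableOn_pow_mul_exp_neg_mul hαz p).const_mul (1 / c))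
    ((ae_restrict_iff' measurableSet_Ioi).2 (ae_of_all _ fun s hs =>
      norm_rayIntegrand_le h1 hc p a hs))

open MeasureTheory in
/-- The expansion `1 / (1 + u) = 1 - u / (1 + u)` with `u = (α s / a)²`. -/
theorem rayIntegral_eq_sub {α z : ℂ} {c : ℝ} (h1 : ‖α‖ = 1) (hαz : 0 < (α * z).re)
    (hc : IsRayBound α c) (p : ℕ) {a : ℝ} (ha : 0 < a) :
    rayIntegral p a α z = p.factorial / z ^ (p + 1) - 1 / (a : ℂ) ^ 2 * rayIntegral (p + 2) a α z := by
  have hα0 : α ≠ 0 := by rintro rfl; simp at h1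
  have ha' : (a : ℂ) ≠ 0 := by exact_mod_cast ha.ne'
  have hi := (integrableOn_pow_mul_cexp_neg_mul hαz p).const_mul (α ^ (p + 1))
  have hi2 := (integrableOn_rayIntegrand h1 hαz hc (p + 2) a).const_mul (1 / (a : ℂ) ^ 2)
  have e : (p.factorial : ℂ) / z ^ (p + 1) =
      ∫ s in Ioi (0 : ℝ), α ^ (p + 1) * ((s : ℂ) ^ p * exp (-(α * z * s))) := by
    rw [integral_const_mul, integral_pow_mul_cexp_neg_mul hαz, mul_pow]
    have := pow_ne_zero (p + 1) hα0
    rw [mul_div_mul_left _ _ this |>.symm]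
    ring
  rw [e, rayIntegral, rayIntegral, ← integral_const_mul (1 / (a : ℂ) ^ 2), ← integral_sub hi hi2]
  refine setIntegral_congr_fun measurableSet_Ioi fun s _ => ?_
  have h0 := hc.ne_zero s a
  rw [show α * s * z = α * z * s by ring, eq_sub_iff_add_eq]
  have e2 : (α * s / a) ^ 2 = 1 / (a : ℂ) ^ 2 * (α * s) ^ 2 := by field_simp
  have e3 : α * ((α * s) ^ p * exp (-(α * z * s)) / (1 + (α * s / a) ^ 2)) +
      1 / (a : ℂ) ^ 2 * (α * ((α * s) ^ (p + 2) * exp (-(α * z * s)) / (1 + (α * s / a) ^ 2))) =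
      α * ((α * s) ^ p * exp (-(α * z * s))) * ((1 + (α * s / a) ^ 2) / (1 + (α * s / a) ^ 2)) := by
    rw [e2]
    ring
  rw [e3, div_self h0]
  ring

/-! ### The Bernoulli numbers -/

/-- `B_{2N+2} = (-1)^N 2 (2N + 2)! ζ(2N + 2) / (2π)^{2N+2}`. -/
theorem hasSum_fourierFreq_inv_pow (N : ℕ) :
    HasSum (fun k : ℕ => 2 / fourierFreq k ^ (2 * N + 2))
      ((-1) ^ N * (bernoulli (2 * N + 2) : ℝ) / (2 * N + 2).factorial) := by
  have h := hasSum_zeta_nat (k := N + 1) (Nat.succ_ne_zero N)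
  rw [← hasSum_nat_add_iff' 1] at h
  have h' := h.mul_left (2 / (2 * Real.pi) ^ (2 * N + 2))
  have hv : 2 / (2 * Real.pi) ^ (2 * N + 2) *
      ((-1 : ℝ) ^ (N + 1 + 1) * 2 ^ (2 * (N + 1) - 1) * Real.pi ^ (2 * (N + 1)) *
        (bernoulli (2 * (N + 1)) : ℝ) / (2 * (N + 1)).factorial -
        ∑ i ∈ Finset.range 1, 1 / (i : ℝ) ^ (2 * (N + 1))) =
      (-1) ^ N * (bernoulli (2 * N + 2) : ℝ) / (2 * N + 2).factorial := by
    have := Real.pi_ne_zero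
    have e : 2 * (N + 1) - 1 = 2 * N + 1 := by omega
    rw [e, show 2 * (N + 1) = 2 * N + 2 by ring]
    simp only [Finset.sum_range_one, Nat.cast_zero, ne_eq, Nat.add_eq_zero_iff,
      OfNat.ofNat_ne_zero, and_false, not_false_eq_true, zero_pow, div_zero, sub_zero]
    have h0 : ((2 * N + 2).factorial : ℝ) ≠ 0 := by positivity
    rw [mul_pow]
    field_simp
    ring
  rw [hv] at h'
  refine h'.congr_fun fun k => ?_
  rw [fourierFreq, mul_pow (2 * Real.pi)]
  push_cast
  have := Real.pi_ne_zero
  rw [show 2 * (N + 1) = 2 * N + 2 by ring]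
  field_simp

theorem factorial_two_mul_add_two {N : ℕ} (hN : 1 ≤ N) :
    ((2 * N + 2).factorial : ℝ) =
      (2 * (N : ℝ) * (2 * (N : ℝ) + 1) * (2 * (N : ℝ) + 2)) * (2 * N - 1).factorial := by
  obtain ⟨m, rfl⟩ := Nat.exists_eq_add_of_le hN
  rw [show 2 * (1 + m) + 2 = (2 * m + 1) + 1 + 1 + 1 by ring, show 2 * (1 + m) - 1 = 2 * m + 1 by omega,
    Nat.factorial_succ, Nat.factorial_succ, Nat.factorial_succ (2 * m + 1)]
  push_cast
  ring

/-- The sum of the moduli of the first neglected terms. -/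
theorem hasSum_fourierFreq_abs {N : ℕ} (hN : 1 ≤ N) :
    HasSum (fun k : ℕ => 2 / fourierFreq k ^ (2 * N + 2) * (2 * N - 1).factorial)
      (|(bernoulli (2 * N + 2) : ℝ)| /
        (2 * (N : ℝ) * (2 * (N : ℝ) + 1) * (2 * (N : ℝ) + 2))) := by
  have h := hasSum_fourierFreq_inv_pow N
  have h0 : 0 ≤ (-1) ^ N * (bernoulli (2 * N + 2) : ℝ) / (2 * N + 2).factorial :=
    h.nonneg fun k => by have := fourierFreq_pos k; positivity
  have e : (-1) ^ N * (bernoulli (2 * N + 2) : ℝ) / (2 * N + 2).factorial =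
      |(bernoulli (2 * N + 2) : ℝ)| / (2 * N + 2).factorial := by
    rw [← abs_of_nonneg h0, abs_div, abs_mul, abs_pow, abs_neg, abs_one, one_pow, one_mul,
      Nat.abs_cast]
  rw [e, factorial_two_mul_add_two hN] at h
  have h' := h.mul_right ((2 * N - 1).factorial : ℝ)
  have h1 : ((2 * N - 1).factorial : ℝ) ≠ 0 := by positivity
  rw [← div_div, div_mul_cancel₀ _ h1] at h'
  exact h'

theorem hasSum_barnesTerm {N : ℕ} (hN : 1 ≤ N) (z : ℂ) :
    HasSum (fun k : ℕ => (((-1) ^ N * (2 / fourierFreq k ^ (2 * N + 2)) : ℝ) : ℂ) *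
      ((2 * N - 1).factorial / z ^ (2 * N))) (barnesTerm N z) := by
  have h := (Complex.hasSum_ofReal.2 ((hasSum_fourierFreq_inv_pow N).mul_left ((-1) ^ N))).mul_right
    ((2 * N - 1).factorial / z ^ (2 * N))
  have e : (((-1) ^ N * ((-1) ^ N * (bernoulli (2 * N + 2) : ℝ) / (2 * N + 2).factorial) : ℝ) : ℂ) *
      ((2 * N - 1).factorial / z ^ (2 * N)) = barnesTerm N z := by
    have hsq : ((-1 : ℝ) ^ N) * (-1) ^ N = 1 := by rw [← mul_pow]; norm_num
    rw [factorial_two_mul_add_two hN, mul_div_assoc, ← mul_assoc, hsq, one_mul, barnesTerm]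
    have h1 : ((2 * N - 1).factorial : ℂ) ≠ 0 := by exact_mod_cast Nat.factorial_ne_zero _
    push_cast
    rw [div_mul_div_comm, mul_right_comm _ ((2 * N - 1).factorial : ℂ),
      mul_div_mul_right _ _ h1]
  rw [e] at h
  exact h

theorem barnesRemainder_sub_succ {N : ℕ} (hN : 1 ≤ N) (z : ℂ) :
    barnesRemainder N z - barnesRemainder (N + 1) z = barnesTerm N z := by
  rw [barnesRemainder, barnesRemainder, Finset.sum_Ico_succ_top hN]
  ring

/-- The representation behind all bounds: `R_N(z)` as a sum of Laplace integrals along the ray through `α`. -/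
theorem hasSum_barnesRemainder {α z : ℂ} (h1 : ‖α‖ = 1) (hα : 0 < α.re) (hαz : 0 < (α * z).re)
    {N : ℕ} (hN : 1 ≤ N) :
    HasSum (fun k : ℕ => (((-1) ^ N * (2 / fourierFreq k ^ (2 * N + 2)) : ℝ) : ℂ) *
      rayIntegral (2 * N - 1) (fourierFreq k) α z) (barnesRemainder N z) := by
  obtain ⟨c, hc⟩ := exists_isRayBound h1 hα
  induction N, hN using Nat.le_induction with
  | base =>
    refine (hasSum_barnesRemainder_one hα hαz).congr_fun fun k => ?_
    norm_num
    ring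
  | succ N hN ih =>
    have h := ih.sub (hasSum_barnesTerm hN z)
    rw [← barnesRemainder_sub_succ hN z, sub_sub_cancel] at h
    refine h.congr_fun fun k => ?_
    have h2 := rayIntegral_eq_sub h1 hαz hc (2 * N - 1) (fourierFreq_pos k)
    rw [show 2 * N - 1 + 1 = 2 * N by omega] at h2
    have hk : (fourierFreq k : ℂ) ≠ 0 := by exact_mod_cast (fourierFreq_pos k).ne'
    rw [show 2 * (N + 1) - 1 = 2 * N - 1 + 2 by omega, h2]
    push_cast
    rw [show 2 * (N + 1) + 2 = 2 * N + 2 + 2 by ring, pow_add _ (2 * N + 2) 2]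
    have hp := pow_ne_zero (2 * N + 2) hk
    field_simp
    ring

theorem norm_barnesRemainder_le {α z : ℂ} {c : ℝ} (h1 : ‖α‖ = 1) (hα : 0 < α.re)
    (hαz : 0 < (α * z).re) (hc : IsRayBound α c) {N : ℕ} (hN : 1 ≤ N) :
    ‖barnesRemainder N z‖ ≤ |(bernoulli (2 * N + 2) : ℝ)| /
        (2 * (N : ℝ) * (2 * (N : ℝ) + 1) * (2 * (N : ℝ) + 2)) *
        (1 / (c * (α * z).re ^ (2 * N))) := by
  have h := hasSum_barnesRemainder h1 hα hαz hN
  have hb := (hasSum_fourierFreq_abs hN).mul_right (1 / (c * (α * z).re ^ (2 * N)))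
  rw [← h.tsum_eq]
  refine tsum_of_norm_bounded hb fun k => ?_
  have hp := fourierFreq_pos k
  have h2 := norm_rayIntegral_le h1 hαz hc (2 * N - 1) (fourierFreq k)
  rw [show 2 * N - 1 + 1 = 2 * N by omega] at h2
  have hc0 := hc.1
  rw [norm_mul, norm_real, norm_mul, norm_pow, norm_neg, norm_one, one_pow, one_mul,
    Real.norm_of_nonneg (by positivity)]
  calc _ ≤ 2 / fourierFreq k ^ (2 * N + 2) *
      (1 / c * ((2 * N - 1).factorial / (α * z).re ^ (2 * N))) := by gcongr
    _ = _ := by field_simp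

/-! ### The error bounds in sectors -/

theorem re_exp_mul_I_mul (z : ℂ) (β : ℝ) :
    (exp (β * I) * z).re = ‖z‖ * Real.cos (z.arg + β) := by
  conv_lhs => rw [← norm_mul_exp_arg_mul_I z]
  rw [show exp (β * I) * (‖z‖ * exp (z.arg * I)) = (‖z‖ : ℂ) * exp ((z.arg + β : ℝ) * I) by
    push_cast
    rw [add_mul, exp_add]
    ring, re_ofReal_mul, exp_ofReal_mul_I_re]

theorem exp_mul_I_sq (β : ℝ) : exp (β * I) ^ 2 = exp ((2 * β : ℝ) * I) := by
  rw [← exp_nat_mul]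
  push_cast
  ring_nf

theorem isRayBound_exp_one {β : ℝ} (h : |β| ≤ Real.pi / 4) : IsRayBound (exp (β * I)) 1 := by
  refine isRayBound_one ?_
  rw [exp_mul_I_sq, exp_ofReal_mul_I_re]
  obtain ⟨h1, h2⟩ := abs_le.1 h
  exact Real.cos_nonneg_of_mem_Icc ⟨by linarith, by linarith⟩

theorem isRayBound_exp_sin {β : ℝ} (h : Real.sin (2 * β) ≠ 0) :
    IsRayBound (exp (β * I)) |Real.sin (2 * β)| := by
  have e : (exp (β * I) ^ 2).im = Real.sin (2 * β) := by
    rw [exp_mul_I_sq, exp_ofReal_mul_I_im]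
  have := isRayBound_abs_im (norm_exp_ofReal_mul_I β) (by rwa [e])
  rwa [e] at this

/-- The bound obtained from the ray `arg s = β`. -/
theorem norm_barnesRemainder_le_of_angle {z : ℂ} (hz : z ≠ 0) {β c : ℝ} (hβ : |β| < Real.pi / 2)
    (hθ : |z.arg + β| < Real.pi / 2) (hc : IsRayBound (exp (β * I)) c) {N : ℕ} (hN : 1 ≤ N)
    {B : ℝ} (hB : 1 / (c * Real.cos (z.arg + β) ^ (2 * N)) ≤ B) :
    ‖barnesRemainder N z‖ ≤ |(bernoulli (2 * N + 2) : ℝ)| /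
      (2 * (N : ℝ) * (2 * (N : ℝ) + 1) * (2 * (N : ℝ) + 2) * ‖z‖ ^ (2 * N)) * B := by
  have hz0 : 0 < ‖z‖ := norm_pos_iff.2 hz
  have hcos : 0 < Real.cos (z.arg + β) := Real.cos_pos_of_mem_Ioo (abs_lt.1 hθ)
  have hα : 0 < (exp (β * I)).re := by
    rw [exp_ofReal_mul_I_re]
    exact Real.cos_pos_of_mem_Ioo (abs_lt.1 hβ)
  have hαz : 0 < (exp (β * I) * z).re := by
    rw [re_exp_mul_I_mul]
    positivity
  have hc0 := hc.1
  refine (norm_barnesRemainder_le (norm_exp_ofReal_mul_I β) hα hαz hc hN).trans ?_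
  rw [re_exp_mul_I_mul]
  calc _ = |(bernoulli (2 * N + 2) : ℝ)| /
      (2 * (N : ℝ) * (2 * (N : ℝ) + 1) * (2 * (N : ℝ) + 2) * ‖z‖ ^ (2 * N)) *
      (1 / (c * Real.cos (z.arg + β) ^ (2 * N))) := by
        rw [mul_pow]
        field_simp
    _ ≤ _ := by gcongr

theorem one_add_inv_pow_le_exp (m : ℕ) : (1 + 1 / ((m : ℝ) + 1)) ^ (m + 1) ≤ Real.exp 1 := by
  have hpos : (0 : ℝ) < (m : ℝ) + 1 := by positivity
  calc (1 + 1 / ((m : ℝ) + 1)) ^ (m + 1) ≤ Real.exp (1 / ((m : ℝ) + 1)) ^ (m + 1) := by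
        gcongr
        rw [add_comm]
        exact Real.add_one_le_exp _
    _ = Real.exp 1 := by
        rw [← Real.exp_nat_mul]
        congr 1
        push_cast
        field_simp

/-- The angle `φ` with `tan φ = (p + 1)^{-1/2}` minimises `1 / (sin 2φ cos^p φ)`. -/
theorem exists_optimal_angle (p : ℕ) : ∃ φ : ℝ, 0 < φ ∧ φ ≤ Real.pi / 4 ∧
    1 / (Real.sin (2 * φ) * Real.cos φ ^ p) ≤
      Real.sqrt (Real.exp 1 / 4 * ((p : ℝ) + 5 / 2)) := by
  have hp : (0 : ℝ) < (p : ℝ) + 1 := by positivity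
  set x : ℝ := 1 / √((p : ℝ) + 1) with hx
  have hx0 : 0 < x := by positivity
  have hx2 : x ^ 2 = 1 / ((p : ℝ) + 1) := by rw [hx, div_pow, Real.sq_sqrt hp.le, one_pow]
  have hx1 : x ≤ 1 := by
    have : x ^ 2 ≤ 1 := by
      rw [hx2, div_le_one hp]
      have : (0 : ℝ) ≤ p := Nat.cast_nonneg p
      linarith
    exact (sq_le_one_iff₀ hx0.le).1 this
  have hφ0 : 0 < Real.arctan x := Real.arctan_pos.2 hx0
  have hφ1 : Real.arctan x ≤ Real.pi / 4 := by
    rw [← Real.arctan_one]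
    exact Real.arctan_strictMono.monotone hx1
  refine ⟨Real.arctan x, hφ0, hφ1, ?_⟩
  set φ := Real.arctan x
  have hcos2 : Real.cos φ ^ 2 = ((p : ℝ) + 1) / ((p : ℝ) + 2) := by
    rw [Real.cos_sq_arctan, hx2]
    field_simp
    ring
  have hsin2 : Real.sin φ ^ 2 = 1 / ((p : ℝ) + 2) := by
    rw [Real.sin_sq, hcos2]
    field_simp
    ring
  have hpi := Real.pi_pos
  have hcos : 0 < Real.cos φ := Real.cos_arctan_pos x
  have hsin : 0 < Real.sin φ := Real.sin_pos_of_pos_of_lt_pi hφ0 (by linarith)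
  refine Real.le_sqrt_of_sq_le ?_
  have e : (1 / (Real.sin (2 * φ) * Real.cos φ ^ p)) ^ 2 =
      ((p : ℝ) + 2) / 4 * (1 + 1 / ((p : ℝ) + 1)) ^ (p + 1) := by
    have h1 : (Real.sin (2 * φ) * Real.cos φ ^ p) ^ 2 =
        4 * Real.sin φ ^ 2 * (Real.cos φ ^ 2) ^ (p + 1) := by
      rw [Real.sin_two_mul]
      ring
    have h2 : 1 + 1 / ((p : ℝ) + 1) = (((p : ℝ) + 1) / ((p : ℝ) + 2))⁻¹ := by
      field_simp
      ring
    rw [div_pow, h1, hcos2, hsin2, h2, inv_pow]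
    field_simp
  rw [e]
  have h := one_add_inv_pow_le_exp p
  have he := Real.exp_pos 1
  calc ((p : ℝ) + 2) / 4 * (1 + 1 / ((p : ℝ) + 1)) ^ (p + 1)
      ≤ ((p : ℝ) + 2) / 4 * Real.exp 1 := by gcongr
    _ ≤ Real.exp 1 / 4 * ((p : ℝ) + 5 / 2) := by nlinarith

/-- Rotation by `φ - |θ|` towards the real axis. -/
theorem exists_rotation (θ φ : ℝ) : ∃ β : ℝ, |β| = abs (|θ| - φ) ∧ |θ + β| = |φ| := by
  rcases le_total 0 θ with h | h
  · exact ⟨φ - θ, by rw [abs_of_nonneg h, abs_sub_comm], by ring_nf⟩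
  · exact ⟨-φ - θ, by rw [abs_of_nonpos h]; ring_nf, by rw [show θ + (-φ - θ) = -φ by ring, abs_neg]⟩

/-- Rotate to `|arg (α z)| = φ₀` with the optimal `φ₀` if `|θ| - φ₀ ≥ π / 4`. Otherwise a rotation by
`π / 4` only is enough, and then `|arg (α z)| < φ₀`. -/
theorem norm_barnesRemainder_le_sqrt {z : ℂ} (hz : z ≠ 0) (h1 : Real.pi / 4 < |z.arg|)
    (h2 : |z.arg| ≤ Real.pi / 2) {N : ℕ} (hN : 1 ≤ N) :
    ‖barnesRemainder N z‖ ≤ |(bernoulli (2 * N + 2) : ℝ)| /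
      (2 * (N : ℝ) * (2 * (N : ℝ) + 1) * (2 * (N : ℝ) + 2) * ‖z‖ ^ (2 * N)) *
      Real.sqrt (Real.exp 1 / 4 * (2 * (N : ℝ) + 5 / 2)) := by
  have hpi := Real.pi_pos
  obtain ⟨φ₀, hφ0, hφ1, hφ⟩ := exists_optimal_angle (2 * N)
  rw [Nat.cast_mul, Nat.cast_two] at hφ
  have hcos0 : 0 < Real.cos φ₀ := Real.cos_pos_of_mem_Ioo ⟨by linarith, by linarith⟩
  have hsin0 : 0 < Real.sin (2 * φ₀) := Real.sin_pos_of_pos_of_lt_pi (by linarith) (by linarith)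
  rcases le_or_gt (Real.pi / 4) (|z.arg| - φ₀) with h | h
  · obtain ⟨β, hβ, hθ⟩ := exists_rotation z.arg φ₀
    rw [abs_of_nonneg (by linarith : 0 ≤ |z.arg| - φ₀)] at hβ
    rw [abs_of_pos hφ0] at hθ
    have hs : Real.sin (2 * φ₀) ≤ |Real.sin (2 * β)| := by
      have e : |Real.sin (2 * β)| = |Real.sin (2 * |β|)| := by
        rcases abs_cases β with ⟨h, _⟩ | ⟨h, _⟩ <;> rw [h]
        rw [mul_neg, Real.sin_neg, abs_neg]
      rw [e, hβ, ← Real.sin_pi_sub (2 * (|z.arg| - φ₀))]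
      refine le_trans ?_ (le_abs_self _)
      exact Real.sin_le_sin_of_le_of_le_pi_div_two (by linarith) (by linarith) (by linarith)
    refine norm_barnesRemainder_le_of_angle hz (by rw [hβ]; linarith) (by rw [hθ]; linarith)
      (isRayBound_exp_sin (abs_pos.1 (hsin0.trans_le hs))) hN (le_trans ?_ hφ)
    rw [← Real.cos_abs (z.arg + β), hθ]
    gcongr
  · obtain ⟨β, hβ, hθ⟩ := exists_rotation z.arg (|z.arg| - Real.pi / 4)
    rw [sub_sub_cancel, abs_of_pos (by linarith : 0 < Real.pi / 4)] at hβ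
    rw [abs_of_pos (by linarith : 0 < |z.arg| - Real.pi / 4)] at hθ
    refine norm_barnesRemainder_le_of_angle hz (by rw [hβ]; linarith) (by rw [hθ]; linarith)
      (isRayBound_exp_one hβ.le) hN (le_trans ?_ hφ)
    rw [← Real.cos_abs (z.arg + β), hθ]
    have hc : Real.cos φ₀ ≤ Real.cos (|z.arg| - Real.pi / 4) :=
      Real.cos_le_cos_of_nonneg_of_le_pi (by linarith) (by linarith) (by linarith)
    have := Real.sin_le_one (2 * φ₀)
    gcongr

theorem norm_barnesRemainder_le_sectorFactor {z : ℂ} (hz : z ≠ 0) (h : |z.arg| ≤ Real.pi / 2)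
    {N : ℕ} (hN : 1 ≤ N) :
    ‖barnesRemainder N z‖ ≤ |(bernoulli (2 * N + 2) : ℝ)| /
      (2 * (N : ℝ) * (2 * (N : ℝ) + 1) * (2 * (N : ℝ) + 2) * ‖z‖ ^ (2 * N)) *
      sectorFactor N z.arg := by
  have hpi := Real.pi_pos
  unfold sectorFactor
  split_ifs with h1 h2
  · refine norm_barnesRemainder_le_of_angle (β := -z.arg) hz (by rw [abs_neg]; linarith)
      (by rw [add_neg_cancel, abs_zero]; linarith) (isRayBound_exp_one (by rwa [abs_neg])) hN ?_
    simp
  · rw [mul_min_of_nonneg _ _ (by positivity)]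
    refine le_min ?_ (norm_barnesRemainder_le_sqrt hz (not_le.1 h1) h hN)
    have hs : Real.sin (2 * -z.arg) ≠ 0 := by
      have h3 : z.arg ≠ 0 := by
        intro h3
        rw [h3, abs_zero] at h1
        exact h1 (by positivity)
      obtain ⟨h4, h5⟩ := abs_lt.1 h2
      rcases lt_or_gt_of_ne h3 with h6 | h6
      · exact (Real.sin_pos_of_pos_of_lt_pi (by linarith) (by linarith)).ne'
      · exact (Real.sin_neg_of_neg_of_neg_pi_lt (by linarith) (by linarith)).ne
    refine norm_barnesRemainder_le_of_angle (β := -z.arg) hz (by rwa [abs_neg])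
      (by rw [add_neg_cancel, abs_zero]; linarith) (isRayBound_exp_sin hs) hN ?_
    rw [mul_neg, Real.sin_neg, abs_neg, abs_inv]
    simp
  · exact norm_barnesRemainder_le_sqrt hz (not_le.1 h1) h hN

/-- The ray bisecting the angle between the positive axis and the direction of `1 / z`. -/
theorem norm_barnesRemainder_le_sec {z : ℂ} (hz : z ≠ 0) (h : |z.arg| < Real.pi)
    {N : ℕ} (hN : 1 ≤ N) :
    ‖barnesRemainder N z‖ ≤ |(bernoulli (2 * N + 2) : ℝ)| /
      (2 * (N : ℝ) * (2 * (N : ℝ) + 1) * (2 * (N : ℝ) + 2) * ‖z‖ ^ (2 * N)) *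
      (Real.cos (z.arg / 2))⁻¹ ^ (2 * N + 1) := by
  have hpi := Real.pi_pos
  have e : z.arg + -(z.arg / 2) = z.arg / 2 := by ring
  have hhalf : |z.arg / 2| < Real.pi / 2 := by
    rw [abs_div, abs_two]
    linarith
  have hβ : |-(z.arg / 2)| < Real.pi / 2 := by rwa [abs_neg]
  have hcos : 0 < Real.cos (z.arg / 2) := Real.cos_pos_of_mem_Ioo (abs_lt.1 hhalf)
  -- each of the two available ray bounds is at least `cos (θ / 2)`
  suffices hc : ∃ c, IsRayBound (exp ((-(z.arg / 2) : ℝ) * I)) c ∧ Real.cos (z.arg / 2) ≤ c by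
    obtain ⟨c, hc, hle⟩ := hc
    refine norm_barnesRemainder_le_of_angle hz hβ (by rwa [e]) hc hN ?_
    rw [e, inv_pow, pow_succ', one_div]
    gcongr
  rcases le_or_gt |z.arg| (Real.pi / 2) with h1 | h1
  · refine ⟨1, isRayBound_exp_one ?_, Real.cos_le_one _⟩
    rw [abs_neg, abs_div, abs_two]
    linarith
  · have hsin : 1 ≤ 2 * |Real.sin (z.arg / 2)| := by
      have h2 : Real.cos z.arg ≤ 0 := by
        rw [← Real.cos_abs]
        exact Real.cos_nonpos_of_pi_div_two_le_of_le h1.le (by linarith)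
      have h3 : Real.cos z.arg = 1 - 2 * Real.sin (z.arg / 2) ^ 2 := by
        have := Real.cos_two_mul (z.arg / 2)
        rw [mul_div_cancel₀ _ two_ne_zero, Real.cos_sq'] at this
        linarith
      rw [← sq_abs] at h3
      nlinarith [abs_nonneg (Real.sin (z.arg / 2))]
    have h4 : |Real.sin (2 * -(z.arg / 2))| =
        2 * |Real.sin (z.arg / 2)| * Real.cos (z.arg / 2) := by
      rw [mul_neg, Real.sin_neg, abs_neg, Real.sin_two_mul, abs_mul, abs_mul, abs_two,
        abs_of_pos hcos]
    have h5 : Real.cos (z.arg / 2) ≤ |Real.sin (2 * -(z.arg / 2))| := by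
      rw [h4]
      nlinarith
    exact ⟨_, isRayBound_exp_sin (abs_pos.1 (hcos.trans_le h5)), h5⟩

/-! ### The sign of the remainder on the positive axis -/

open MeasureTheory in
theorem rayIntegral_one_ofReal {x : ℝ} (hx : 0 < x) (p : ℕ) (a : ℝ) :
    ∃ y : ℝ, 0 < y ∧ rayIntegral p a 1 x = (y : ℂ) := by
  let g : ℝ → ℝ := fun s => s ^ p * Real.exp (-(s * x)) / (1 + (s / a) ^ 2)
  have e : ∀ s : ℝ, (1 : ℂ) * ((1 * (s : ℂ)) ^ p * exp (-(1 * (s : ℂ) * x)) /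
      (1 + (1 * (s : ℂ) / a) ^ 2)) = ((g s : ℝ) : ℂ) := by
    intro s
    simp only [one_mul, g]
    push_cast
    rfl
  refine ⟨∫ s in Ioi (0 : ℝ), g s, ?_, ?_⟩
  · have hi := (integrableOn_rayIntegrand (α := 1) (z := x) norm_one (by simpa using hx)
      (isRayBound_one (by simp)) p a).re
    simp only [e] at hi
    have hi' : IntegrableOn g (Ioi 0) := hi
    have hpos : ∀ s ∈ Ioi (0 : ℝ), 0 < g s := fun s hs => by
      have : (0 : ℝ) < s := hs
      simp only [g]
      positivity
    rw [setIntegral_pos_iff_support_of_nonneg_ae _ hi']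
    · have : Function.support g ∩ Ioi 0 = Ioi 0 :=
        inter_eq_right.2 fun s hs => (hpos s hs).ne'
      rw [this]
      simp
    · exact (ae_restrict_iff' measurableSet_Ioi).2 (ae_of_all _ fun s hs => (hpos s hs).le)
  · rw [rayIntegral]
    simp only [e]
    exact integral_ofReal

/-- On the ray `α = 1` the integrals are real and positive. -/
theorem barnesRemainder_ofReal {x : ℝ} (hx : 0 < x) {N : ℕ} (hN : 1 ≤ N) :
    ∃ ρ : ℝ, 0 < ρ ∧ barnesRemainder N x = (((-1) ^ N * ρ : ℝ) : ℂ) := by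
  choose y hy0 hy using fun k => rayIntegral_one_ofReal hx (2 * N - 1) (fourierFreq k)
  have h := hasSum_barnesRemainder (α := 1) (z := x) norm_one (by simp) (by simpa using hx) hN
  have e : ∀ k : ℕ, (((-1) ^ N * (2 / fourierFreq k ^ (2 * N + 2)) : ℝ) : ℂ) *
      rayIntegral (2 * N - 1) (fourierFreq k) 1 x =
      (((-1) ^ N * (2 / fourierFreq k ^ (2 * N + 2) * y k) : ℝ) : ℂ) := by
    intro k
    rw [hy]
    push_cast
    ring
  simp only [e] at h
  have h' := h.mul_left ((-1 : ℂ) ^ N)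
  have hsq : ((-1 : ℂ) ^ N) * (-1) ^ N = 1 := by rw [← mul_pow]; norm_num
  have e2 : ∀ k : ℕ, (-1 : ℂ) ^ N * (((-1) ^ N * (2 / fourierFreq k ^ (2 * N + 2) * y k) : ℝ) : ℂ) =
      ((2 / fourierFreq k ^ (2 * N + 2) * y k : ℝ) : ℂ) := by
    intro k
    push_cast
    rw [← mul_assoc, hsq, one_mul]
  simp only [e2] at h'
  have hs : Summable fun k : ℕ => 2 / fourierFreq k ^ (2 * N + 2) * y k :=
    Complex.summable_ofReal.1 h'.summable
  have hpos : ∀ k, 0 < 2 / fourierFreq k ^ (2 * N + 2) * y k := fun k => by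
    have := fourierFreq_pos k
    have := hy0 k
    positivity
  refine ⟨∑' k : ℕ, 2 / fourierFreq k ^ (2 * N + 2) * y k,
    hs.tsum_pos (fun k => (hpos k).le) 0 (hpos 0), ?_⟩
  have h3 := h'.tsum_eq
  rw [← ofReal_tsum] at h3
  rw [ofReal_mul, h3]
  push_cast
  rw [← mul_assoc, hsq, one_mul]

/-- The first neglected term is `R_N - R_{N+1}`, a difference of numbers of opposite signs. -/
theorem barnesRemainder_sign {x : ℝ} (hx : 0 < x) {N : ℕ} (hN : 1 ≤ N) :
    ∃ r t : ℝ, barnesRemainder N (x : ℂ) = (r : ℂ) ∧ barnesTerm N (x : ℂ) = (t : ℂ) ∧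
      t ≠ 0 ∧ SignType.sign r = SignType.sign t ∧ |r| < |t| := by
  obtain ⟨ρ, hρ, h1⟩ := barnesRemainder_ofReal hx hN
  obtain ⟨ρ', hρ', h2⟩ := barnesRemainder_ofReal hx (by omega : 1 ≤ N + 1)
  refine ⟨(-1) ^ N * ρ, (-1) ^ N * (ρ + ρ'), h1, ?_, ?_, ?_, ?_⟩
  · rw [← barnesRemainder_sub_succ hN, h1, h2]
    push_cast
    ring
  · exact mul_ne_zero (pow_ne_zero _ (by norm_num)) (by positivity)
  · rw [sign_mul, sign_mul, sign_pos hρ, sign_pos (add_pos hρ hρ')]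
  · rw [abs_mul, abs_mul, abs_pow, abs_neg, abs_one, one_pow, one_mul, one_mul, abs_of_pos hρ,
      abs_of_pos (add_pos hρ hρ')]
    linarith

/-! ### The three bounds together -/

theorem theorem2 (N : ℕ) (hN : 1 ≤ N) :
    (∀ z : ℂ, z ≠ 0 → |z.arg| ≤ Real.pi / 2 →
      ‖barnesRemainder N z‖ ≤
        |(bernoulli (2 * N + 2) : ℝ)| /
          (2 * (N : ℝ) * (2 * (N : ℝ) + 1) * (2 * (N : ℝ) + 2) * ‖z‖ ^ (2 * N)) *
          sectorFactor N z.arg) ∧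
    (∀ z : ℂ, z ≠ 0 → |z.arg| < Real.pi →
      ‖barnesRemainder N z‖ ≤
        |(bernoulli (2 * N + 2) : ℝ)| /
          (2 * (N : ℝ) * (2 * (N : ℝ) + 1) * (2 * (N : ℝ) + 2) * ‖z‖ ^ (2 * N)) *
          (Real.cos (z.arg / 2))⁻¹ ^ (2 * N + 1)) ∧
    (∀ x : ℝ, 0 < x →
      ∃ r t : ℝ, barnesRemainder N (x : ℂ) = (r : ℂ) ∧ barnesTerm N (x : ℂ) = (t : ℂ) ∧
        t ≠ 0 ∧ SignType.sign r = SignType.sign t ∧ |r| < |t|) := by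
  exact ⟨fun z hz h => norm_barnesRemainder_le_sectorFactor hz h hN,
    fun z hz h => norm_barnesRemainder_le_sec hz h hN, fun x hx => barnesRemainder_sign hx hN⟩
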